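/- Let $X$ be a real Banach space which is reflexive and locally uniformly rotund (LUR), where a norm $\|\cdot\|$ is called LUR if, whenever $\|x\|=\|x_n\|=1$ for all $n\in\mathbb N$ and $\|\tfrac12(x+x_n)\|\to 1$, one has $\|x_n-x\|\to 0$. Let $\Omega\subsetneq X$ be a non-empty, open, convex set, and for $z\in\Omega$ let $d(z)$ denote the distance from $z$ to the boundary $\partial\Omega$. For $x,y\in\Omega$ let $$k(x,y)=\inf_\gamma\int_\gamma\frac{\|d\gamma\|}{d(\gamma)}$$ be the quasihyperbolic distance, where the infimum is taken over all rectifiable paths $\gamma$ in $\Omega$ joining $x$ to $y$ and the integral is taken with respect to arc length. (i) Let $x_0,y,y_n\in\Omega$ ($n\in\mathbb N$) be such that $k(x_0,y_n)=k(x_0,y)$ for all $n$ and $k\bigl(x_0,\tfrac12(y+y_n)\bigr)\to k(x_0,y)$ as $n\to\infty$. Then $y_n\to y$ in norm. (ii) If moreover $\Omega$ is symmetric, that is $-\Omega=\Omega$, then for every $r>0$ the Minkowski functional of the quasihyperbolic ball of centre $0$ and radius $r$ in $\Omega$, both of the open ball $\{y\in\Omega: k(0,y)<r\}$ and of the closed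 ball $\{y\in\Omega: k(0,y)\le r\}$, is a norm on $X$ which is equivalent to $\|\cdot\|$ and LUR. -/

import Mathlib

open Set Filter Topology

noncomputable section

/-- The function `p` (in the applications a norm on `X`) is locally uniformly rotund: if `x` and
`u n` lie on the unit sphere of `p` and `p ((x + u n) / 2) → 1`, then `p (u n - x) → 0`. -/
def IsLUR {X : Type*} [AddCommGroup X] [Module ℝ X] (p : X → ℝ) : Prop :=
  ∀ (x : X) (u : ℕ → X), p x = 1 → (∀ n, p (u n) = 1) →
    Tendsto (fun n => p ((1 / 2 : ℝ) • (x + u n))) atTop (𝓝 1) →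
    Tendsto (fun n => p (u n - x)) atTop (𝓝 0)

/-- A real normed space is locally uniformly rotund if its norm is. -/
def IsLURSpace (X : Type*) [NormedAddCommGroup X] [NormedSpace ℝ X] : Prop :=
  IsLUR (fun x : X => ‖x‖)

/-- A real normed space is reflexive if the canonical embedding into its bidual is onto. -/
def IsReflexiveSpace (X : Type*) [NormedAddCommGroup X] [NormedSpace ℝ X] : Prop :=
  Function.Surjective (NormedSpace.inclusionInDoubleDual ℝ X)

/-- `p` is a norm on the vector space `X`, equivalent to the given norm of `X`
(definiteness of `p` follows from the lower estimate). -/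
structure IsEquivalentNorm {X : Type*} [NormedAddCommGroup X] [NormedSpace ℝ X]
    (p : X → ℝ) : Prop where
  add_le : ∀ x y : X, p (x + y) ≤ p x + p y
  smul : ∀ (a : ℝ) (x : X), p (a • x) = |a| * p x
  equivalent : ∃ c C : ℝ, 0 < c ∧ 0 < C ∧ ∀ x : X, c * ‖x‖ ≤ p x ∧ p x ≤ C * ‖x‖

/-- The line integral `∫_γ ρ ds` of a real function `ρ` along a rectifiable path
`γ : [a, b] → X`, that is `∫ s in 0..ℓ, ρ (γ₀ s)`, where `ℓ` is the length (total variation) of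
`γ` and `γ₀ : [0, ℓ] → X` is the parametrization of `γ` by arc length. -/
def arcLengthIntegral {X : Type*} [NormedAddCommGroup X] (ρ : X → ℝ) (γ : ℝ → X)
    (a b : ℝ) : ℝ :=
  ∫ s in (0 : ℝ)..(variationOnFromTo γ (Icc a b) a b),
    ρ (naturalParameterization γ (Icc a b) a s)

/-- `γ : [a, b] → X` is a rectifiable path in `Ω` from `x` to `y`: it is continuous and of
finite length, its image lies in `Ω`, and its end points are `x` and `y`. -/
structure IsRectifiablePath {X : Type*} [NormedAddCommGroup X] (Ω : Set X) (x y : X)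
    (γ : ℝ → X) (a b : ℝ) : Prop where
  le : a ≤ b
  continuousOn : ContinuousOn γ (Icc a b)
  rectifiable : BoundedVariationOn γ (Icc a b)
  mapsTo : MapsTo γ (Icc a b) Ω
  source : γ a = x
  target : γ b = y

/-- The quasihyperbolic length `∫_γ ‖dγ‖ / d(γ)` in `Ω` of a rectifiable path `γ : [a, b] → Ω`,
where `d` denotes the distance to the boundary of `Ω`. -/
def qhLength {X : Type*} [NormedAddCommGroup X] (Ω : Set X) (γ : ℝ → X) (a b : ℝ) : ℝ :=
  arcLengthIntegral (fun z => 1 / Metric.infDist z (frontier Ω)) γ a b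

/-- The quasihyperbolic distance of two points `x, y` of a domain `Ω`: the infimum of the
quasihyperbolic lengths of the rectifiable paths in `Ω` joining `x` and `y`. -/
def qhDist {X : Type*} [NormedAddCommGroup X] (Ω : Set X) (x y : X) : ℝ :=
  sInf {l : ℝ | ∃ (γ : ℝ → X) (a b : ℝ), IsRectifiablePath Ω x y γ a b ∧ l = qhLength Ω γ a b}

/-- The open quasihyperbolic ball of centre `x` and radius `r`. -/
def qhBall {X : Type*} [NormedAddCommGroup X] (Ω : Set X) (x : X) (r : ℝ) : Set X :=
  {y | y ∈ Ω ∧ qhDist Ω x y < r}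

/-- The closed quasihyperbolic ball of centre `x` and radius `r`. -/
def qhClosedBall {X : Type*} [NormedAddCommGroup X] (Ω : Set X) (x : X) (r : ℝ) : Set X :=
  {y | y ∈ Ω ∧ qhDist Ω x y ≤ r}

end

/-! Say that a curve in `Ω` has speed at most one if it satisfies `IsQHCurve`. Then `k(x, y)` is the
infimum of the times in which such a curve leads from `x` to `y`
(`IsRectifiablePath.exists_isQHCurve`, `IsQHCurve.qhLength_le`). As `Ω` is convex, `d` is concave on
it, so convex combinations of such curves again have speed at most one (`IsQHCurve.convex_comb`). By
reflexivity the class is also stable under weak limits, so geodesics exist.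

For (i), let `γ` be a geodesic from `x₀` to `y` and `c n` geodesics from `x₀` to `u n`, all of
duration `R`. The distance `K n t` from `x₀` to the midpoint of `γ t` and `c n t` is 1-Lipschitz in
`t`, vanishes at `0` and tends to `R` at `t = R`; hence its derivative tends to `1` a.e. along a
subsequence. At such `t` the midpoint moves at nearly the maximal speed, which is at least `(d(γ) +
d(c n)) / 2`, while `γ` and `c n` move at speeds at most `d(γ)` and `d(c n)`. Rotundity at `γ'`
forces `c n' ≈ (d(c n) / d(γ)) γ'`, so `‖c n' - γ'‖ ≤ |d(c n) - d(γ)| + o(1) ≤ ‖c n - γ‖ + o(1)`,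
and Grönwall's inequality gives `u n → y`.

Of the curves only `γ` needs a derivative, and only along an ultrafilter of step sizes
(`IsQHCurve.ae_tendsto_slope`): the weak limits of its difference quotients have full norm `d(γ)`
a.e., because a geodesic wastes no length, and the Kadets-Klee property makes the limits strong.

For (ii), the unit sphere of the Minkowski functional lies on the quasihyperbolic sphere, and (i)
applies to it. -/

noncomputable section

/-! ### Distance to the boundary of a convex domain. -/

/-- The distance of a point to the boundary of `Ω`. -/
abbrev bdryDist {X : Type*} [NormedAddCommGroup X] (Ω : Set X) (z : X) : ℝ :=
  Metric.infDist z (frontier Ω)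

theorem bdryDist_le_add {X : Type*} [NormedAddCommGroup X] {Ω : Set X} (x y : X) : bdryDist Ω x ≤ bdryDist Ω y + ‖x - y‖ := by
  rw [← dist_eq_norm]; exact Metric.infDist_le_infDist_add_dist

theorem abs_bdryDist_sub_le {X : Type*} [NormedAddCommGroup X] {Ω : Set X} (x y : X) : |bdryDist Ω x - bdryDist Ω y| ≤ ‖x - y‖ := by
  rw [abs_le]
  have h1 := bdryDist_le_add (Ω := Ω) x y
  have h2 := bdryDist_le_add (Ω := Ω) y x
  rw [norm_sub_rev] at h2
  constructor <;> linarith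

/-- A non-empty open convex set different from the whole space. -/
structure IsProperConvexDomain {X : Type*} [NormedAddCommGroup X] [NormedSpace ℝ X]
    (Ω : Set X) : Prop where
  isOpen : IsOpen Ω
  nonempty : Ω.Nonempty
  ne_univ : Ω ≠ univ
  convex : Convex ℝ Ω

namespace IsProperConvexDomain

variable {X : Type*} [NormedAddCommGroup X] [NormedSpace ℝ X] {Ω : Set X}

theorem frontier_nonempty (h : IsProperConvexDomain Ω) : (frontier Ω).Nonempty :=
  nonempty_frontier_iff.2 ⟨h.nonempty, h.ne_univ⟩

theorem bdryDist_pos (h : IsProperConvexDomain Ω) {z : X} (hz : z ∈ Ω) : 0 < bdryDist Ω z := by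
  refine (isClosed_frontier.notMem_iff_infDist_pos h.frontier_nonempty).1 fun hz' => ?_
  exact (disjoint_frontier_iff_isOpen.2 h.isOpen).le_bot ⟨hz', hz⟩

theorem le_bdryDist_of_ball_subset (h : IsProperConvexDomain Ω) {z : X} {c : ℝ}
    (hc : Metric.ball z c ⊆ Ω) : c ≤ bdryDist Ω z := by
  refine (Metric.le_infDist h.frontier_nonempty).2 fun w hw => ?_
  by_contra! hlt
  have : w ∈ Ω := hc (by rwa [Metric.mem_ball, dist_comm])
  exact (disjoint_frontier_iff_isOpen.2 h.isOpen).le_bot ⟨hw, this⟩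

/-- The ball is connected, meets `Ω` and misses its frontier. -/
theorem ball_subset (h : IsProperConvexDomain Ω) {z : X} (hz : z ∈ Ω) :
    Metric.ball z (bdryDist Ω z) ⊆ Ω := by
  refine (convex_ball z (bdryDist Ω z)).isPreconnected.subset_left_of_subset_union h.isOpen
    isClosed_closure.isOpen_compl
    (disjoint_compl_right.mono_left subset_closure) (fun w hw => ?_)
    ⟨z, Metric.mem_ball_self (h.bdryDist_pos hz), hz⟩
  by_contra hw'
  rw [mem_union, not_or, mem_compl_iff, not_not] at hw'
  have h1 : w ∈ frontier Ω := by rw [h.isOpen.frontier_eq]; exact ⟨hw'.2, hw'.1⟩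
  have h2 : bdryDist Ω z ≤ dist z w := Metric.infDist_le_dist_of_mem h1
  rw [Metric.mem_ball, dist_comm] at hw
  linarith

/-- A point of the ball about `a • x + b • y` whose radius is the averaged distance is the same
convex combination of points of the balls about `x` and `y`, displaced in one common direction `e`.
-/
theorem bdryDist_concave (h : IsProperConvexDomain Ω) {x y : X} (hx : x ∈ Ω) (hy : y ∈ Ω)
    {a b : ℝ} (ha : 0 ≤ a) (hb : 0 ≤ b) (hab : a + b = 1) :
    a * bdryDist Ω x + b * bdryDist Ω y ≤ bdryDist Ω (a • x + b • y) := by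
  apply h.le_bdryDist_of_ball_subset
  intro w hw
  have hdx := h.bdryDist_pos hx
  have hdy := h.bdryDist_pos hy
  set D := a * bdryDist Ω x + b * bdryDist Ω y with hD
  have hDpos : 0 < D := by
    rcases ha.eq_or_lt with rfl | ha'
    · have : b = 1 := by linarith
      rw [hD, this]; simpa using hdy
    · have := mul_pos ha' hdx
      have := mul_nonneg hb hdy.le
      linarith
  set e : X := D⁻¹ • (w - (a • x + b • y)) with he
  have hnorm : ‖e‖ < 1 := by
    rw [he, norm_smul, norm_inv, Real.norm_of_nonneg hDpos.le, ← dist_eq_norm,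
      inv_mul_lt_iff₀ hDpos, mul_one]
    exact hw
  have hmem : ∀ z ∈ Ω, z + bdryDist Ω z • e ∈ Ω := by
    intro z hz
    apply h.ball_subset hz
    have := h.bdryDist_pos hz
    rw [Metric.mem_ball, dist_eq_norm, add_sub_cancel_left, norm_smul,
      Real.norm_of_nonneg this.le]
    nlinarith
  have hw' : w = a • (x + bdryDist Ω x • e) + b • (y + bdryDist Ω y • e) := by
    have h1 : w = (a • x + b • y) + D • e := by
      rw [he, smul_inv_smul₀ hDpos.ne']; abel
    rw [h1, hD]; module
  rw [hw']
  exact h.convex (hmem x hx) (hmem y hy) ha hb hab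

theorem mem_and_le_bdryDist_iff (h : IsProperConvexDomain Ω) {z : X} {c : ℝ} (hc : 0 < c) :
    (z ∈ Ω ∧ c ≤ bdryDist Ω z) ↔ Metric.ball z c ⊆ Ω :=
  ⟨fun hz => (Metric.ball_subset_ball hz.2).trans (h.ball_subset hz.1),
    fun hz => ⟨hz (Metric.mem_ball_self hc), h.le_bdryDist_of_ball_subset hz⟩⟩

/-- Closed in `X`, not merely relatively in `Ω`: inclusion of an open ball in `Ω` passes to limits
of centres. With convexity this makes the set weakly closed. -/
theorem isClosed_setOf_le_bdryDist (h : IsProperConvexDomain Ω) {c : ℝ} (hc : 0 < c) :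
    IsClosed {z | z ∈ Ω ∧ c ≤ bdryDist Ω z} := by
  rw [← isSeqClosed_iff_isClosed]
  intro u z hu hz
  refine (h.mem_and_le_bdryDist_iff hc).2 fun w hw => ?_
  rw [Metric.mem_ball] at hw
  have : Tendsto (fun n => dist w (u n)) atTop (𝓝 (dist w z)) := tendsto_const_nhds.dist hz
  obtain ⟨n, hn⟩ := (this.eventually (gt_mem_nhds hw)).exists
  exact (h.mem_and_le_bdryDist_iff hc).1 (hu n) hn

theorem convex_setOf_le_bdryDist (h : IsProperConvexDomain Ω) (c : ℝ) :
    Convex ℝ {z | z ∈ Ω ∧ c ≤ bdryDist Ω z} := by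
  intro x hx y hy a b ha hb hab
  refine ⟨h.convex hx.1 hy.1 ha hb hab, ?_⟩
  refine le_trans ?_ (h.bdryDist_concave hx.1 hy.1 ha hb hab)
  have h1 := mul_le_mul_of_nonneg_left hx.2 ha
  have h2 := mul_le_mul_of_nonneg_left hy.2 hb
  calc c = a * c + b * c := by rw [← add_mul, hab, one_mul]
    _ ≤ _ := add_le_add h1 h2

end IsProperConvexDomain

/-! ### An exponential growth estimate. -/

section Integral

/-- Integrate `1 / f s ≥ 1 / (D + (s - a))` to a logarithm and exponentiate. In use, `f` is the
boundary distance along an arc-length parametrization. -/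
theorem add_le_mul_exp_integral {f : ℝ → ℝ} {a b D : ℝ} (hab : a ≤ b)
    (hc : ContinuousOn f (Icc a b)) (hpos : ∀ s ∈ Icc a b, 0 < f s)
    (hle : ∀ s ∈ Icc a b, f s ≤ D + (s - a)) :
    D + (b - a) ≤ D * Real.exp (∫ s in a..b, 1 / f s) := by
  have hD : 0 < D := by
    have h1 := hpos a (left_mem_Icc.2 hab)
    have h2 := hle a (left_mem_Icc.2 hab)
    linarith
  have hDs : ∀ s ∈ Icc a b, 0 < D + (s - a) := fun s hs => by linarith [hs.1]
  have hint : ∫ s in a..b, 1 / (D + (s - a)) = Real.log (D + (b - a)) - Real.log (D + (a - a)) := by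
    refine intervalIntegral.integral_eq_sub_of_hasDerivAt
      (f := fun s => Real.log (D + (s - a))) (fun s hs => ?_) ?_
    · rw [uIcc_of_le hab] at hs
      exact (((hasDerivAt_id s).sub_const a).const_add D).log (hDs s hs).ne'
    · refine ContinuousOn.intervalIntegrable ?_
      rw [uIcc_of_le hab]
      exact continuousOn_const.div (by fun_prop) fun s hs => (hDs s hs).ne'
  have hmono : ∫ s in a..b, 1 / (D + (s - a)) ≤ ∫ s in a..b, 1 / f s := by
    refine intervalIntegral.integral_mono_on hab ?_ ?_ fun s hs =>
      one_div_le_one_div_of_le (hpos s hs) (hle s hs)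
    · refine ContinuousOn.intervalIntegrable ?_
      rw [uIcc_of_le hab]
      exact continuousOn_const.div (by fun_prop) fun s hs => (hDs s hs).ne'
    · refine ContinuousOn.intervalIntegrable ?_
      rw [uIcc_of_le hab]
      exact continuousOn_const.div hc fun s hs => (hpos s hs).ne'
  rw [hint, sub_self, add_zero] at hmono
  have hb := hDs b (right_mem_Icc.2 hab)
  calc D + (b - a) = D * Real.exp (Real.log (D + (b - a)) - Real.log D) := by
        rw [Real.exp_sub, Real.exp_log hb, Real.exp_log hD]; field_simp
    _ ≤ _ := by gcongr

theorem add_le_mul_exp_integral' {f : ℝ → ℝ} {a b D : ℝ} (hab : a ≤ b)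
    (hc : ContinuousOn f (Icc a b)) (hpos : ∀ s ∈ Icc a b, 0 < f s)
    (hle : ∀ s ∈ Icc a b, f s ≤ D + (b - s)) :
    D + (b - a) ≤ D * Real.exp (∫ s in a..b, 1 / f s) := by
  have hmaps : MapsTo (fun s : ℝ => -s) (Icc (-b) (-a)) (Icc a b) := fun s hs =>
    ⟨by linarith [hs.2], by linarith [hs.1]⟩
  have := add_le_mul_exp_integral (f := fun s => f (-s)) (D := D) (neg_le_neg hab)
    (hc.comp (by fun_prop) hmaps) (fun s hs => hpos _ (hmaps hs))
    (fun s hs => (hle _ (hmaps hs)).trans (by linarith))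
  rw [intervalIntegral.integral_comp_neg (fun s => 1 / f s), neg_neg, neg_neg] at this
  linarith

end Integral

/-! ### Parametrization by arc length. -/

section NaturalParameterization

variable {X : Type*} [NormedAddCommGroup X] {γ : ℝ → X} {a b : ℝ}

/-- The jumps of the variation are the jumps of `γ`, which vanish by continuity. -/
theorem continuousOn_variationOnFromTo (hab : a ≤ b) (hc : ContinuousOn γ (Icc a b))
    (hv : BoundedVariationOn γ (Icc a b)) :
    ContinuousOn (variationOnFromTo γ (Icc a b) a) (Icc a b) := by
  intro x hx
  have hl := hv.locallyBoundedVariationOn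
  have ha : a ∈ Icc a b := left_mem_Icc.2 hab
  have h1 := variationOnFromTo.tendsto_left ha hx hl
    ((hc x hx).mono_left (nhdsWithin_mono x inter_subset_left))
  have h2 := variationOnFromTo.tendsto_right ha hx hl
    ((hc x hx).mono_left (nhdsWithin_mono x inter_subset_left))
  rw [dist_self, sub_zero] at h1
  rw [dist_self, add_zero] at h2
  have h3 : ContinuousWithinAt (variationOnFromTo γ (Icc a b) a)
      (insert x (Icc a b ∩ Iio x ∪ Icc a b ∩ Ioi x)) x := by
    rw [continuousWithinAt_insert_self]
    exact ContinuousWithinAt.union h1 h2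
  refine h3.mono fun y hy => ?_
  rcases lt_trichotomy y x with h | h | h
  · exact Or.inr (Or.inl ⟨hy, h⟩)
  · exact Or.inl h
  · exact Or.inr (Or.inr ⟨hy, h⟩)

theorem image_variationOnFromTo (hab : a ≤ b) (hc : ContinuousOn γ (Icc a b))
    (hv : BoundedVariationOn γ (Icc a b)) :
    variationOnFromTo γ (Icc a b) a '' Icc a b =
      Icc 0 (variationOnFromTo γ (Icc a b) a b) := by
  have hl := hv.locallyBoundedVariationOn
  have hm := variationOnFromTo.monotoneOn hl (left_mem_Icc.2 hab)
  refine Subset.antisymm ?_ ?_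
  · rintro _ ⟨t, ht, rfl⟩
    exact ⟨variationOnFromTo.nonneg_of_le γ _ ht.1, hm ht (right_mem_Icc.2 hab) ht.2⟩
  · have := intermediate_value_Icc hab (continuousOn_variationOnFromTo hab hc hv)
    rwa [variationOnFromTo.self] at this

theorem naturalParameterization_variationOnFromTo (hv : BoundedVariationOn γ (Icc a b))
    {t : ℝ} (ht : t ∈ Icc a b) :
    naturalParameterization γ (Icc a b) a (variationOnFromTo γ (Icc a b) a t) = γ t :=
  edist_eq_zero.1 (edist_naturalParameterization_eq_zero hv.locallyBoundedVariationOn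
    (left_mem_Icc.2 (ht.1.trans ht.2)) ht)

theorem lipschitzOnWith_naturalParameterization (hab : a ≤ b) (hc : ContinuousOn γ (Icc a b))
    (hv : BoundedVariationOn γ (Icc a b)) :
    LipschitzOnWith 1 (naturalParameterization γ (Icc a b) a)
      (Icc 0 (variationOnFromTo γ (Icc a b) a b)) := by
  have hu := has_unit_speed_naturalParameterization γ hv.locallyBoundedVariationOn
    (left_mem_Icc.2 hab)
  rw [image_variationOnFromTo hab hc hv] at hu
  have key : ∀ x ∈ Icc 0 (variationOnFromTo γ (Icc a b) a b),
      ∀ y ∈ Icc 0 (variationOnFromTo γ (Icc a b) a b), x ≤ y →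
      edist (naturalParameterization γ (Icc a b) a x) (naturalParameterization γ (Icc a b) a y)
        ≤ edist x y := by
    intro x hx y hy hxy
    have h1 := eVariationOn.edist_le (naturalParameterization γ (Icc a b) a)
      (s := Icc 0 (variationOnFromTo γ (Icc a b) a b) ∩ Icc x y)
      (x := x) (y := y) ⟨hx, left_mem_Icc.2 hxy⟩ ⟨hy, right_mem_Icc.2 hxy⟩
    rw [hu hx hy] at h1
    refine h1.trans ?_
    rw [edist_dist, dist_comm, Real.dist_eq, abs_of_nonneg (sub_nonneg.2 hxy)]
    simp
  intro x hx y hy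
  rw [ENNReal.coe_one, one_mul]
  rcases le_total x y with h | h
  · exact key x hx y hy h
  · rw [edist_comm, edist_comm x]; exact key y hy x hx h

end NaturalParameterization

/-! ### Curves of quasihyperbolic speed at most one. -/

/-- A curve in `Ω` whose quasihyperbolic speed is at most one, in integrated form. -/
structure IsQHCurve {X : Type*} [NormedAddCommGroup X] (Ω : Set X) (γ : ℝ → X) : Prop where
  mem : ∀ t, γ t ∈ Ω
  norm_sub_le : ∀ s t, ‖γ t - γ s‖ ≤ bdryDist Ω (γ s) * (Real.exp |t - s| - 1)

section Clamp

/-- The projection of the line onto the interval `[0, r]`. -/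
def clamp (r t : ℝ) : ℝ := max 0 (min r t)

theorem clamp_mem {r : ℝ} (hr : 0 ≤ r) (t : ℝ) : clamp r t ∈ Icc 0 r :=
  ⟨le_max_left _ _, max_le hr (min_le_left _ _)⟩

theorem clamp_of_mem {r t : ℝ} (ht : t ∈ Icc 0 r) : clamp r t = t := by
  rw [clamp, min_eq_right ht.2, max_eq_right ht.1]

theorem abs_clamp_sub_le (r s t : ℝ) : |clamp r t - clamp r s| ≤ |t - s| := by
  have h1 : |clamp r t - clamp r s| ≤ |min r t - min r s| := by
    simpa [clamp] using abs_max_sub_max_le_max 0 (min r t) 0 (min r s)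
  have h2 : |min r t - min r s| ≤ |t - s| := by
    simpa using abs_min_sub_min_le_max r t r s
  exact h1.trans h2

/-- Freezing a curve at its end points preserves the bound, since `clamp` is nonexpansive. -/
theorem IsQHCurve.of_Icc {X : Type*} [NormedAddCommGroup X] {Ω : Set X} {γ : ℝ → X} {r : ℝ}
    (hr : 0 ≤ r) (hmem : ∀ t ∈ Icc 0 r, γ t ∈ Ω)
    (hle : ∀ s ∈ Icc 0 r, ∀ t ∈ Icc 0 r,
      ‖γ t - γ s‖ ≤ bdryDist Ω (γ s) * (Real.exp |t - s| - 1)) :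
    IsQHCurve Ω (fun t => γ (clamp r t)) where
  mem t := hmem _ (clamp_mem hr t)
  norm_sub_le s t := by
    refine (hle _ (clamp_mem hr s) _ (clamp_mem hr t)).trans ?_
    have := abs_clamp_sub_le r s t
    have h0 : 0 ≤ bdryDist Ω (γ (clamp r s)) := Metric.infDist_nonneg
    gcongr

end Clamp

/-! ### From rectifiable paths to curves of speed at most one. -/

section PathToCurve

variable {X : Type*} [NormedAddCommGroup X] {Ω : Set X} {x y : X} {γ : ℝ → X} {a b : ℝ}

theorem IsRectifiablePath.naturalParameterization_mem (hγ : IsRectifiablePath Ω x y γ a b) {s : ℝ}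
    (hs : s ∈ Icc 0 (variationOnFromTo γ (Icc a b) a b)) :
    naturalParameterization γ (Icc a b) a s ∈ Ω := by
  rw [← image_variationOnFromTo hγ.le hγ.continuousOn hγ.rectifiable] at hs
  obtain ⟨t, ht, rfl⟩ := hs
  rw [naturalParameterization_variationOnFromTo hγ.rectifiable ht]
  exact hγ.mapsTo ht

theorem IsRectifiablePath.continuousOn_naturalParameterization
    (hγ : IsRectifiablePath Ω x y γ a b) :
    ContinuousOn (naturalParameterization γ (Icc a b) a)
      (Icc 0 (variationOnFromTo γ (Icc a b) a b)) :=
  (lipschitzOnWith_naturalParameterization hγ.le hγ.continuousOn hγ.rectifiable).continuousOn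

theorem IsRectifiablePath.qhLength_nonneg (hγ : IsRectifiablePath Ω x y γ a b) :
    0 ≤ qhLength Ω γ a b :=
  intervalIntegral.integral_nonneg (variationOnFromTo.nonneg_of_le γ _ hγ.le) fun _ _ =>
    one_div_nonneg.2 Metric.infDist_nonneg

variable [NormedSpace ℝ X]

theorem IsRectifiablePath.continuousOn_density (hΩ : IsProperConvexDomain Ω)
    (hγ : IsRectifiablePath Ω x y γ a b) :
    ContinuousOn (fun s => 1 / bdryDist Ω (naturalParameterization γ (Icc a b) a s))
      (Icc 0 (variationOnFromTo γ (Icc a b) a b)) :=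
  continuousOn_const.div
    ((Metric.continuous_infDist_pt _).comp_continuousOn hγ.continuousOn_naturalParameterization)
    fun _ hs => (hΩ.bdryDist_pos (hγ.naturalParameterization_mem hs)).ne'

/-- Arc length and `d` are both 1-Lipschitz, so `d` grows at most linearly away from `s`; the
exponential estimate applies forwards or backwards in time. -/
theorem IsRectifiablePath.norm_sub_le (hΩ : IsProperConvexDomain Ω)
    (hγ : IsRectifiablePath Ω x y γ a b) {s t : ℝ}
    (hs : s ∈ Icc 0 (variationOnFromTo γ (Icc a b) a b))
    (ht : t ∈ Icc 0 (variationOnFromTo γ (Icc a b) a b)) :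
    ‖naturalParameterization γ (Icc a b) a t - naturalParameterization γ (Icc a b) a s‖ ≤
      bdryDist Ω (naturalParameterization γ (Icc a b) a s) *
        (Real.exp |∫ τ in s..t, 1 / bdryDist Ω (naturalParameterization γ (Icc a b) a τ)| - 1) := by
  set g := naturalParameterization γ (Icc a b) a with hg
  set ℓ := variationOnFromTo γ (Icc a b) a b
  have hlip : ∀ p ∈ Icc 0 ℓ, ∀ q ∈ Icc 0 ℓ, ‖g p - g q‖ ≤ |p - q| := by
    intro p hp q hq
    have := (lipschitzOnWith_naturalParameterization hγ.le hγ.continuousOn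
      hγ.rectifiable).dist_le_mul p hp q hq
    rwa [NNReal.coe_one, one_mul, dist_eq_norm, Real.dist_eq] at this
  have hcont : ContinuousOn (fun τ => bdryDist Ω (g τ)) (Icc 0 ℓ) :=
    (Metric.continuous_infDist_pt _).comp_continuousOn hγ.continuousOn_naturalParameterization
  have hpos : ∀ τ ∈ Icc 0 ℓ, 0 < bdryDist Ω (g τ) := fun τ hτ =>
    hΩ.bdryDist_pos (hγ.naturalParameterization_mem hτ)
  have hab := hlip t ht s hs
  rcases le_total s t with hst | hts
  · have hsub : Icc s t ⊆ Icc 0 ℓ := Icc_subset_Icc hs.1 ht.2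
    have h1 := add_le_mul_exp_integral (D := bdryDist Ω (g s)) hst (hcont.mono hsub)
      (fun τ hτ => hpos τ (hsub hτ)) fun τ hτ => by
        have := hlip τ (hsub hτ) s hs
        rw [abs_of_nonneg (sub_nonneg.2 hτ.1)] at this
        linarith [bdryDist_le_add (Ω := Ω) (g τ) (g s)]
    have h2 : 0 ≤ ∫ τ in s..t, 1 / bdryDist Ω (g τ) :=
      intervalIntegral.integral_nonneg hst fun τ hτ => (one_div_pos.2 (hpos τ (hsub hτ))).le
    rw [abs_of_nonneg h2]
    rw [abs_of_nonneg (sub_nonneg.2 hst)] at hab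
    linarith
  · have hsub : Icc t s ⊆ Icc 0 ℓ := Icc_subset_Icc ht.1 hs.2
    have h1 := add_le_mul_exp_integral' (D := bdryDist Ω (g s)) hts (hcont.mono hsub)
      (fun τ hτ => hpos τ (hsub hτ)) fun τ hτ => by
        have := hlip τ (hsub hτ) s hs
        rw [abs_sub_comm, abs_of_nonneg (sub_nonneg.2 hτ.2)] at this
        linarith [bdryDist_le_add (Ω := Ω) (g τ) (g s)]
    have h2 : 0 ≤ ∫ τ in t..s, 1 / bdryDist Ω (g τ) :=
      intervalIntegral.integral_nonneg hts fun τ hτ => (one_div_pos.2 (hpos τ (hsub hτ))).le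
    rw [intervalIntegral.integral_symm, abs_neg, abs_of_nonneg h2]
    rw [abs_sub_comm, abs_of_nonneg (sub_nonneg.2 hts)] at hab
    linarith

/-- Reparametrize by quasihyperbolic length: compose the arc-length parametrization with a right
inverse `σ` of `s ↦ ∫ 0..s, 1 / d`. -/
theorem IsRectifiablePath.exists_isQHCurve (hΩ : IsProperConvexDomain Ω)
    (hγ : IsRectifiablePath Ω x y γ a b) :
    ∃ c : ℝ → X, IsQHCurve Ω c ∧ c 0 = x ∧ c (qhLength Ω γ a b) = y := by
  set g := naturalParameterization γ (Icc a b) a with hg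
  set ℓ := variationOnFromTo γ (Icc a b) a b with hℓ
  have hℓ0 : 0 ≤ ℓ := variationOnFromTo.nonneg_of_le γ _ hγ.le
  set ρ : ℝ → ℝ := fun s => 1 / bdryDist Ω (g s) with hρ
  set L := qhLength Ω γ a b with hL
  have hL0 : 0 ≤ L := hγ.qhLength_nonneg
  have hLeq : L = ∫ s in (0 : ℝ)..ℓ, ρ s := rfl
  have hρc : ContinuousOn ρ (Icc 0 ℓ) := hγ.continuousOn_density hΩ
  have hρi : IntervalIntegrable ρ MeasureTheory.volume 0 ℓ :=
    ContinuousOn.intervalIntegrable (by rwa [uIcc_of_le hℓ0])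
  have hg0 : g 0 = x := by
    have := naturalParameterization_variationOnFromTo hγ.rectifiable (left_mem_Icc.2 hγ.le)
    rwa [variationOnFromTo.self, hγ.source] at this
  have hgℓ : g ℓ = y := by
    have := naturalParameterization_variationOnFromTo hγ.rectifiable (right_mem_Icc.2 hγ.le)
    rwa [hγ.target] at this
  have hρsub : ∀ s ∈ Icc 0 ℓ, ∀ t ∈ Icc 0 ℓ, (∫ τ in (0 : ℝ)..t, ρ τ) - ∫ τ in (0 : ℝ)..s, ρ τ =
      ∫ τ in s..t, ρ τ := by
    intro s hs t ht
    refine intervalIntegral.integral_interval_sub_left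
      (hρi.mono_set ?_) (hρi.mono_set ?_) <;>
      rw [uIcc_of_le hℓ0] <;> [rw [uIcc_of_le ht.1]; rw [uIcc_of_le hs.1]]
    exacts [Icc_subset_Icc_right ht.2, Icc_subset_Icc_right hs.2]
  have hkey : ∀ s ∈ Icc 0 ℓ, ∀ t ∈ Icc 0 ℓ, ‖g t - g s‖ ≤ bdryDist Ω (g s) *
      (Real.exp |(∫ τ in (0 : ℝ)..t, ρ τ) - ∫ τ in (0 : ℝ)..s, ρ τ| - 1) := by
    intro s hs t ht
    rw [hρsub s hs t ht]
    exact hγ.norm_sub_le hΩ hs ht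
  have hMc : ContinuousOn (fun s => ∫ τ in (0 : ℝ)..s, ρ τ) (Icc 0 ℓ) := by
    have := intervalIntegral.continuousOn_primitive_interval
      (μ := MeasureTheory.volume) (a := 0) (b := ℓ) (f := ρ)
      (by rw [uIcc_of_le hℓ0]; exact (intervalIntegrable_iff_integrableOn_Icc_of_le hℓ0).1 hρi)
    rwa [uIcc_of_le hℓ0] at this
  have hivt := intermediate_value_Icc hℓ0 hMc
  simp only [intervalIntegral.integral_same] at hivt
  have hex : ∀ r : ℝ, ∃ s, r ∈ Icc 0 L → s ∈ Icc 0 ℓ ∧ ∫ τ in (0 : ℝ)..s, ρ τ = r := by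
    intro r
    by_cases hr : r ∈ Icc 0 L
    · obtain ⟨s, hs, hsr⟩ := hivt hr
      exact ⟨s, fun _ => ⟨hs, hsr⟩⟩
    · exact ⟨0, fun h => absurd h hr⟩
  choose σ hσ using hex
  -- The choice of `σ` is immaterial: parameters with equal quasihyperbolic length give the same
  -- point.
  have hmatch : ∀ r ∈ Icc 0 L, ∀ s ∈ Icc 0 ℓ, ∫ τ in (0 : ℝ)..s, ρ τ = r → g (σ r) = g s := by
    intro r hr s hs hsr
    have := hkey s hs (σ r) (hσ r hr).1
    rw [(hσ r hr).2, hsr, sub_self, abs_zero, Real.exp_zero, sub_self, mul_zero] at this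
    exact sub_eq_zero.1 (norm_le_zero_iff.1 this)
  refine ⟨fun t => g (σ (clamp L t)), IsQHCurve.of_Icc (γ := fun t => g (σ t)) hL0
    (fun t ht => hγ.naturalParameterization_mem (hσ t ht).1) (fun s hs t ht => ?_), ?_, ?_⟩
  · have := hkey (σ s) (hσ s hs).1 (σ t) (hσ t ht).1
    rwa [(hσ t ht).2, (hσ s hs).2] at this
  · simp only
    rw [clamp_of_mem (left_mem_Icc.2 hL0), hmatch 0 (left_mem_Icc.2 hL0) 0 (left_mem_Icc.2 hℓ0)
      intervalIntegral.integral_same, hg0]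
  · simp only
    rw [clamp_of_mem (right_mem_Icc.2 hL0), hmatch L (right_mem_Icc.2 hL0) ℓ
      (right_mem_Icc.2 hℓ0) hLeq.symm, hgℓ]

end PathToCurve

theorem exp_sub_one_le_mul_exp (u : ℝ) : Real.exp u - 1 ≤ u * Real.exp u := by
  have h := Real.add_one_le_exp (-u)
  have h2 : Real.exp (-u) * Real.exp u = 1 := by rw [← Real.exp_add]; simp
  nlinarith [Real.exp_pos u]

/-! ### Regularity and concatenation of such curves. -/

namespace IsQHCurve

variable {X : Type*} [NormedAddCommGroup X] {Ω : Set X} {γ : ℝ → X}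

theorem bdryDist_le (h : IsQHCurve Ω γ) (s t : ℝ) :
    bdryDist Ω (γ t) ≤ bdryDist Ω (γ s) * Real.exp |t - s| := by
  have h1 := h.norm_sub_le s t
  have h2 := bdryDist_le_add (Ω := Ω) (γ t) (γ s)
  linarith

/-- One factor `exp (t - s)` comes from the growth of `d` along the curve, the other from `exp u - 1
≤ u * exp u`. -/
theorem norm_sub_le_mul (h : IsQHCurve Ω γ) {s t p q : ℝ} (hp : p ∈ Icc s t) (hq : q ∈ Icc s t) :
    ‖γ p - γ q‖ ≤ bdryDist Ω (γ s) * Real.exp (2 * (t - s)) * |p - q| := by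
  have h1 := h.norm_sub_le q p
  have h2 := h.bdryDist_le s q
  rw [abs_of_nonneg (sub_nonneg.2 hq.1)] at h2
  have h3 : |p - q| ≤ t - s := by rw [abs_le]; constructor <;> linarith [hp.1, hp.2, hq.1, hq.2]
  have h4 := exp_sub_one_le_mul_exp |p - q|
  have hd : 0 ≤ bdryDist Ω (γ s) := Metric.infDist_nonneg
  have hd' : 0 ≤ bdryDist Ω (γ q) := Metric.infDist_nonneg
  calc ‖γ p - γ q‖ ≤ bdryDist Ω (γ q) * (|p - q| * Real.exp |p - q|) := by
        refine h1.trans ?_; gcongr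
    _ ≤ (bdryDist Ω (γ s) * Real.exp (t - s)) * (|p - q| * Real.exp (t - s)) := by
        have : bdryDist Ω (γ q) ≤ bdryDist Ω (γ s) * Real.exp (t - s) := by
          refine h2.trans ?_; gcongr; exact hq.2
        gcongr
    _ = _ := by rw [two_mul, Real.exp_add]; ring

theorem lipschitzOnWith (h : IsQHCurve Ω γ) (s t : ℝ) :
    LipschitzOnWith (Real.toNNReal (bdryDist Ω (γ s) * Real.exp (2 * (t - s)))) γ (Icc s t) := by
  refine LipschitzOnWith.of_dist_le_mul fun p hp q hq => ?_
  rw [Real.coe_toNNReal _ (mul_nonneg Metric.infDist_nonneg (Real.exp_pos _).le), dist_eq_norm,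
    Real.dist_eq]
  exact h.norm_sub_le_mul hp hq

theorem eVariationOn_le (h : IsQHCurve Ω γ) {s t : ℝ} (hst : s ≤ t) :
    eVariationOn γ (Icc s t) ≤
      ENNReal.ofReal (bdryDist Ω (γ s) * Real.exp (2 * (t - s)) * (t - s)) := by
  have h1 := (h.lipschitzOnWith s t).comp_eVariationOn_le (g := id) (s := Icc s t) (mapsTo_id _)
  have h2 : eVariationOn (id : ℝ → ℝ) (Icc s t) ≤ ENNReal.ofReal (t - s) := by
    have := (monotoneOn_id (s := Icc s t)).eVariationOn_eq (left_mem_Icc.2 hst) (right_mem_Icc.2 hst)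
    rw [inter_self] at this; exact this.le
  rw [Function.comp_id] at h1
  refine h1.trans ?_
  rw [ENNReal.ofReal_mul (mul_nonneg Metric.infDist_nonneg (Real.exp_pos _).le)]
  exact mul_le_mul_right h2 _

theorem continuous (h : IsQHCurve Ω γ) : Continuous γ := by
  rw [continuous_iff_continuousAt]
  intro t
  exact ((h.lipschitzOnWith (t - 1) (t + 1)).continuousOn).continuousAt
    (Icc_mem_nhds (by linarith) (by linarith))

theorem isRectifiablePath (h : IsQHCurve Ω γ) {R : ℝ} (hR : 0 ≤ R) :
    IsRectifiablePath Ω (γ 0) (γ R) γ 0 R where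
  le := hR
  continuousOn := h.continuous.continuousOn
  rectifiable := ne_top_of_le_ne_top ENNReal.ofReal_ne_top (h.eVariationOn_le hR)
  mapsTo t _ := h.mem t
  source := rfl
  target := rfl

theorem comp_add (h : IsQHCurve Ω γ) (c : ℝ) : IsQHCurve Ω fun t => γ (t + c) where
  mem t := h.mem _
  norm_sub_le s t := by simpa using h.norm_sub_le (s + c) (t + c)

theorem comp_sub_left (h : IsQHCurve Ω γ) (c : ℝ) : IsQHCurve Ω fun t => γ (c - t) where
  mem t := h.mem _
  norm_sub_le s t := by
    have := h.norm_sub_le (c - s) (c - t)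
    rwa [sub_sub_sub_cancel_left, abs_sub_comm] at this

theorem comp_clamp (h : IsQHCurve Ω γ) {R : ℝ} (hR : 0 ≤ R) :
    IsQHCurve Ω fun t => γ (clamp R t) :=
  IsQHCurve.of_Icc hR (fun t _ => h.mem t) fun s _ t _ => h.norm_sub_le s t

/-- Across the junction, `e^{u+v} - 1 = (e^u - 1) + e^u (e^v - 1)`, and the factor `e^u` absorbs the
growth of `d` up to the junction. -/
theorem concat {γ₁ γ₂ : ℝ → X} (h₁ : IsQHCurve Ω γ₁) (h₂ : IsQHCurve Ω γ₂) (R : ℝ)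
    (hR : γ₁ R = γ₂ 0) : IsQHCurve Ω fun t => if t ≤ R then γ₁ t else γ₂ (t - R) where
  mem t := by split_ifs; exacts [h₁.mem _, h₂.mem _]
  norm_sub_le s t := by
    have hexp : ∀ u v : ℝ, Real.exp (u + v) = Real.exp u * Real.exp v := Real.exp_add
    split_ifs with ht hs hs
    · exact h₁.norm_sub_le s t
    · push Not at hs
      have e1 := h₂.norm_sub_le (s - R) 0
      have e2 := h₁.norm_sub_le R t
      have e3 := h₂.bdryDist_le (s - R) 0
      rw [abs_of_nonpos (by linarith)] at e1 e3
      rw [abs_of_nonpos (by linarith), hR] at e2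
      rw [abs_of_nonpos (by linarith)]
      have e4 : ‖γ₁ t - γ₂ (s - R)‖ ≤ ‖γ₂ 0 - γ₂ (s - R)‖ + ‖γ₁ t - γ₂ 0‖ := by
        rw [add_comm]; exact norm_sub_le_norm_sub_add_norm_sub ..
      have e5 : 0 ≤ Real.exp (-(t - R)) - 1 := by
        rw [sub_nonneg]; exact Real.one_le_exp (by linarith)
      have e6 := mul_le_mul_of_nonneg_right e3 e5
      have e7 : Real.exp (-(t - s)) = Real.exp (-(0 - (s - R))) * Real.exp (-(t - R)) := by
        rw [← hexp]; congr 1; ring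
      rw [e7]
      linarith
    · push Not at ht
      have e1 := h₁.norm_sub_le s R
      have e2 := h₂.norm_sub_le 0 (t - R)
      have e3 := h₁.bdryDist_le s R
      rw [abs_of_nonneg (by linarith)] at e1 e2 e3
      rw [abs_of_nonneg (by linarith)]
      rw [hR] at e1 e3
      have e4 : ‖γ₂ (t - R) - γ₁ s‖ ≤ ‖γ₂ 0 - γ₁ s‖ + ‖γ₂ (t - R) - γ₂ 0‖ := by
        rw [add_comm]; exact norm_sub_le_norm_sub_add_norm_sub ..
      have e5 : 0 ≤ Real.exp (t - R - 0) - 1 := by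
        rw [sub_nonneg]; exact Real.one_le_exp (by linarith)
      have e6 := mul_le_mul_of_nonneg_right e3 e5
      have e7 : Real.exp (t - s) = Real.exp (R - s) * Real.exp (t - R - 0) := by
        rw [← hexp]; congr 1; ring
      rw [e7]
      linarith
    · have := h₂.norm_sub_le (s - R) (t - R)
      rwa [sub_sub_sub_cancel_right] at this

end IsQHCurve

/-- Telescope over `n + 1` equal pieces; the exponential factor tends to `1` as the mesh shrinks. -/
theorem sub_le_of_forall_sub_le_exp_mul {N : ℝ → ℝ} {R C : ℝ} (hR : 0 ≤ R)
    (h : ∀ s ∈ Icc 0 R, ∀ t ∈ Icc 0 R, s ≤ t → N t - N s ≤ Real.exp (C * (t - s)) * (t - s)) :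
    N R - N 0 ≤ R := by
  have key : ∀ n : ℕ, N R - N 0 ≤ Real.exp (C * (R / ((n : ℝ) + 1))) * R := by
    intro n
    have hn : (0 : ℝ) < (n : ℝ) + 1 := by positivity
    have hsum := Finset.sum_range_sub (fun i : ℕ => N (i * (R / ((n : ℝ) + 1)))) (n + 1)
    have hbd : ∀ i ∈ Finset.range (n + 1), N ((i + 1 : ℕ) * (R / ((n : ℝ) + 1))) -
        N (i * (R / ((n : ℝ) + 1))) ≤
        Real.exp (C * (R / ((n : ℝ) + 1))) * (R / ((n : ℝ) + 1)) := by
      intro i hi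
      have hi' : (i : ℝ) + 1 ≤ (n : ℝ) + 1 := by
        exact_mod_cast Finset.mem_range.1 hi
      have hstep : 0 ≤ R / ((n : ℝ) + 1) := by positivity
      have htop : ((n : ℝ) + 1) * (R / ((n : ℝ) + 1)) = R := by field_simp
      have h2 : ((i : ℝ) + 1) * (R / ((n : ℝ) + 1)) ≤ R := by
        exact (mul_le_mul_of_nonneg_right hi' hstep).trans_eq htop
      have h1 : (i : ℝ) * (R / ((n : ℝ) + 1)) ≤ ((i : ℝ) + 1) * (R / ((n : ℝ) + 1)) := by
        gcongr; linarith
      have h0 : 0 ≤ (i : ℝ) * (R / ((n : ℝ) + 1)) := by positivity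
      have := h (i * (R / ((n : ℝ) + 1))) ⟨h0, h1.trans h2⟩
        (((i + 1 : ℕ) : ℝ) * (R / ((n : ℝ) + 1))) (by push_cast; exact ⟨h0.trans h1, h2⟩)
        (by push_cast; exact h1)
      have hd : ((i + 1 : ℕ) : ℝ) * (R / ((n : ℝ) + 1)) - i * (R / ((n : ℝ) + 1)) =
        R / ((n : ℝ) + 1) := by push_cast; ring
      rwa [hd] at this
    have hle := Finset.sum_le_sum hbd
    rw [hsum, Finset.sum_const, Finset.card_range, nsmul_eq_mul] at hle
    have hend : ((n + 1 : ℕ) : ℝ) * (R / ((n : ℝ) + 1)) = R := by push_cast; field_simp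
    rw [hend, Nat.cast_zero, zero_mul] at hle
    calc N R - N 0 ≤ _ := hle
      _ = Real.exp (C * (R / ((n : ℝ) + 1))) * (((n + 1 : ℕ) : ℝ) * (R / ((n : ℝ) + 1))) := by ring
      _ = _ := by rw [hend]
  have hlim : Tendsto (fun n : ℕ => Real.exp (C * (R / ((n : ℝ) + 1))) * R) atTop
      (𝓝 (Real.exp (C * 0) * R)) := by
    have h1 : Tendsto (fun n : ℕ => R / ((n : ℝ) + 1)) atTop (𝓝 0) := by
      have := (tendsto_one_div_add_atTop_nhds_zero_nat (𝕜 := ℝ)).const_mul R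
      simpa [div_eq_mul_inv] using this
    exact ((Real.continuous_exp.tendsto _).comp (h1.const_mul C)).mul_const R
  have := ge_of_tendsto' hlim key
  simpa using this

/-! ### From curves of speed at most one back to path length. -/

section CurveToPath

variable {X : Type*} [NormedAddCommGroup X] [NormedSpace ℝ X] {Ω : Set X} {γ : ℝ → X}

theorem IsQHCurve.qhLength_le (hΩ : IsProperConvexDomain Ω) (h : IsQHCurve Ω γ) {R : ℝ}
    (hR : 0 ≤ R) : qhLength Ω γ 0 R ≤ R := by
  have hγ := h.isRectifiablePath hR
  set g := naturalParameterization γ (Icc 0 R) 0 with hg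
  set v := variationOnFromTo γ (Icc 0 R) 0 with hv
  have hl := hγ.rectifiable.locallyBoundedVariationOn
  have hρc : ContinuousOn (fun s => 1 / bdryDist Ω (g s)) (Icc 0 (v R)) :=
    hγ.continuousOn_density hΩ
  have hvmono : MonotoneOn v (Icc 0 R) := variationOnFromTo.monotoneOn hl (left_mem_Icc.2 hR)
  have hvmem : ∀ t ∈ Icc 0 R, v t ∈ Icc 0 (v R) := fun t ht =>
    ⟨variationOnFromTo.nonneg_of_le γ _ ht.1, hvmono ht (right_mem_Icc.2 hR) ht.2⟩
  have hvc : ContinuousOn v (Icc 0 R) :=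
    continuousOn_variationOnFromTo hR hγ.continuousOn hγ.rectifiable
  -- Over time `h` the arc length is at most `d(γ s) e^{2h} h` and the density at most `e^h / d(γ
  -- s)`; hence `C = 3`.
  have key := sub_le_of_forall_sub_le_exp_mul (N := fun t => ∫ s in (0 : ℝ)..v t, 1 / bdryDist Ω (g s))
    (C := 3) hR ?_
  · have h0 : v 0 = 0 := variationOnFromTo.self ..
    simp only [h0, intervalIntegral.integral_same, sub_zero] at key
    exact key
  intro s hs t ht hst
  have hii : ∀ p ∈ Icc 0 (v R), ∀ q ∈ Icc 0 (v R), IntervalIntegrable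
      (fun s => 1 / bdryDist Ω (g s)) MeasureTheory.volume p q := fun p hp q hq =>
    ContinuousOn.intervalIntegrable (hρc.mono (uIcc_subset_Icc hp hq))
  have hzero : (0 : ℝ) ∈ Icc 0 (v R) := left_mem_Icc.2 (hvmem R (right_mem_Icc.2 hR)).1
  rw [intervalIntegral.integral_interval_sub_left (hii _ hzero _ (hvmem t ht))
    (hii _ hzero _ (hvmem s hs))]
  have hvst : v t - v s ≤ bdryDist Ω (γ s) * Real.exp (2 * (t - s)) * (t - s) := by
    rw [hv, variationOnFromTo.sub_right hl (left_mem_Icc.2 hR) ht hs]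
    rw [variationOnFromTo.eq_of_le _ _ hst]
    have hsub : Icc 0 R ∩ Icc s t = Icc s t :=
      inter_eq_right.2 (Icc_subset_Icc hs.1 ht.2)
    rw [hsub]
    have hd : 0 ≤ bdryDist Ω (γ s) := Metric.infDist_nonneg
    exact ENNReal.toReal_le_of_le_ofReal
      (mul_nonneg (mul_nonneg hd (Real.exp_pos _).le) (sub_nonneg.2 hst)) (h.eVariationOn_le hst)
  have hds : 0 < bdryDist Ω (γ s) := hΩ.bdryDist_pos (h.mem s)
  have hbound : ∀ σ ∈ Icc (v s) (v t), 1 / bdryDist Ω (g σ) ≤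
      Real.exp (t - s) / bdryDist Ω (γ s) := by
    intro σ hσ
    obtain ⟨p, hp, rfl⟩ := intermediate_value_Icc hst
      (hvc.mono (Icc_subset_Icc hs.1 ht.2)) hσ
    have hpR : p ∈ Icc 0 R := ⟨hs.1.trans hp.1, hp.2.trans ht.2⟩
    have hgp : g (v p) = γ p := naturalParameterization_variationOnFromTo hγ.rectifiable hpR
    rw [hgp, div_le_div_iff₀ (hΩ.bdryDist_pos (h.mem p)) hds, one_mul]
    have := h.bdryDist_le p s
    rw [abs_sub_comm, abs_of_nonneg (sub_nonneg.2 hp.1)] at this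
    calc _ ≤ _ := this
      _ ≤ bdryDist Ω (γ p) * Real.exp (t - s) := by
        have := (hΩ.bdryDist_pos (h.mem p)).le
        gcongr; exact hp.2
      _ = _ := mul_comm _ _
  have hvle := hvmono hs ht hst
  calc ∫ σ in v s..v t, 1 / bdryDist Ω (g σ)
      ≤ ∫ _ in v s..v t, Real.exp (t - s) / bdryDist Ω (γ s) :=
        intervalIntegral.integral_mono_on hvle (hii _ (hvmem s hs) _ (hvmem t ht))
          intervalIntegrable_const hbound
    _ = (v t - v s) * (Real.exp (t - s) / bdryDist Ω (γ s)) := by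
        rw [intervalIntegral.integral_const, smul_eq_mul]
    _ ≤ (bdryDist Ω (γ s) * Real.exp (2 * (t - s)) * (t - s)) *
          (Real.exp (t - s) / bdryDist Ω (γ s)) := by gcongr
    _ = Real.exp (3 * (t - s)) * (t - s) := by
        have : Real.exp (3 * (t - s)) = Real.exp (2 * (t - s)) * Real.exp (t - s) := by
          rw [← Real.exp_add]; congr 1; ring
        rw [this]; field_simp

end CurveToPath

theorem clamp_of_le {r t : ℝ} (hr : 0 ≤ r) (h : r ≤ t) : clamp r t = r := by
  rw [clamp, min_eq_left h, max_eq_right hr]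

theorem clamp_zero {r : ℝ} (hr : 0 ≤ r) : clamp r 0 = 0 :=
  clamp_of_mem (left_mem_Icc.2 hr)

/-! ### The quasihyperbolic distance as minimal travel time. -/

section Distance

variable {X : Type*} [NormedAddCommGroup X] {Ω : Set X} {x y z : X}

theorem bddBelow_qhLength : BddBelow {l : ℝ | ∃ (γ : ℝ → X) (a b : ℝ),
    IsRectifiablePath Ω x y γ a b ∧ l = qhLength Ω γ a b} := by
  refine ⟨0, ?_⟩
  rintro _ ⟨γ, a, b, hγ, rfl⟩
  exact hγ.qhLength_nonneg

theorem qhDist_nonneg (Ω : Set X) (x y : X) : 0 ≤ qhDist Ω x y := by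
  refine Real.sInf_nonneg ?_
  rintro _ ⟨γ, a, b, hγ, rfl⟩
  exact hγ.qhLength_nonneg

variable [NormedSpace ℝ X]

theorem IsQHCurve.qhDist_le (hΩ : IsProperConvexDomain Ω) {γ : ℝ → X} (h : IsQHCurve Ω γ)
    {R : ℝ} (hR : 0 ≤ R) : qhDist Ω (γ 0) (γ R) ≤ R :=
  (csInf_le bddBelow_qhLength ⟨γ, 0, R, h.isRectifiablePath hR, rfl⟩).trans (h.qhLength_le hΩ hR)

theorem IsQHCurve.qhDist_le_abs (hΩ : IsProperConvexDomain Ω) {γ : ℝ → X} (h : IsQHCurve Ω γ)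
    (s t : ℝ) : qhDist Ω (γ s) (γ t) ≤ |t - s| := by
  rcases le_total s t with hst | hts
  · rw [abs_of_nonneg (sub_nonneg.2 hst)]
    simpa using (h.comp_add s).qhDist_le hΩ (sub_nonneg.2 hst)
  · rw [abs_sub_comm, abs_of_nonneg (sub_nonneg.2 hts)]
    simpa using (h.comp_sub_left s).qhDist_le hΩ (sub_nonneg.2 hts)

namespace IsProperConvexDomain

/-- By concavity `d ≥ c` on the whole segment, so constant norm speed `c` is admissible. -/
theorem exists_isQHCurve_segment (hΩ : IsProperConvexDomain Ω) (hx : x ∈ Ω) (hy : y ∈ Ω) {c : ℝ}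
    (hc : 0 < c) (hcx : c ≤ bdryDist Ω x) (hcy : c ≤ bdryDist Ω y) :
    ∃ γ : ℝ → X, IsQHCurve Ω γ ∧ γ 0 = x ∧ γ (‖x - y‖ / c) = y := by
  rcases eq_or_ne x y with rfl | hxy
  · refine ⟨fun _ => x, ⟨fun _ => hx, fun s t => ?_⟩, rfl, rfl⟩
    rw [sub_self, norm_zero]
    exact mul_nonneg Metric.infDist_nonneg (sub_nonneg.2 (Real.one_le_exp (abs_nonneg _)))
  have hΔ : 0 < ‖x - y‖ := norm_pos_iff.2 (sub_ne_zero.2 hxy)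
  set R := ‖x - y‖ / c with hR
  have hRpos : 0 < R := div_pos hΔ hc
  have hmem : ∀ t ∈ Icc 0 R, AffineMap.lineMap x y (t / R) ∈ {z | z ∈ Ω ∧ c ≤ bdryDist Ω z} := by
    intro t ht
    exact (hΩ.convex_setOf_le_bdryDist c).lineMap_mem ⟨hx, hcx⟩ ⟨hy, hcy⟩
      ⟨div_nonneg ht.1 hRpos.le, (div_le_one hRpos).2 ht.2⟩
  refine ⟨fun t => AffineMap.lineMap x y (clamp R t / R), IsQHCurve.of_Icc
    (γ := fun t => AffineMap.lineMap x y (t / R)) hRpos.le (fun t ht => (hmem t ht).1)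
    (fun s hs t ht => ?_), ?_, ?_⟩
  · have h1 : ‖AffineMap.lineMap x y (t / R) - AffineMap.lineMap x y (s / R)‖ = c * |t - s| := by
      rw [← dist_eq_norm, dist_lineMap_lineMap, dist_eq_norm x y, Real.dist_eq, ← sub_div, abs_div,
        abs_of_pos hRpos, hR]
      field_simp
    rw [h1]
    have h2 : |t - s| ≤ Real.exp |t - s| - 1 := by linarith [Real.add_one_le_exp |t - s|]
    exact mul_le_mul (hmem s hs).2 h2 (abs_nonneg _) Metric.infDist_nonneg
  · simp [clamp_zero hRpos.le]
  · simp [clamp_of_le hRpos.le le_rfl, hRpos.ne']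

/-- Some path has length below `R`; its reparametrization waits at `y` until time `R`. -/
theorem exists_isQHCurve_of_lt (hΩ : IsProperConvexDomain Ω) (hx : x ∈ Ω) (hy : y ∈ Ω) {R : ℝ}
    (hR : qhDist Ω x y < R) : ∃ γ : ℝ → X, IsQHCurve Ω γ ∧ γ 0 = x ∧ γ R = y := by
  have hne : {l : ℝ | ∃ (γ : ℝ → X) (a b : ℝ),
      IsRectifiablePath Ω x y γ a b ∧ l = qhLength Ω γ a b}.Nonempty := by
    have hc : 0 < min (bdryDist Ω x) (bdryDist Ω y) :=
      lt_min (hΩ.bdryDist_pos hx) (hΩ.bdryDist_pos hy)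
    obtain ⟨γ, hγ, h0, h1⟩ := hΩ.exists_isQHCurve_segment hx hy hc (min_le_left _ _)
      (min_le_right _ _)
    have := hγ.isRectifiablePath (R := ‖x - y‖ / min (bdryDist Ω x) (bdryDist Ω y)) (by positivity)
    rw [h0, h1] at this
    exact ⟨_, γ, 0, _, this, rfl⟩
  obtain ⟨_, ⟨γ, a, b, hγ, rfl⟩, hlt⟩ := exists_lt_of_csInf_lt hne hR
  obtain ⟨c, hc, h0, h1⟩ := hγ.exists_isQHCurve hΩ
  refine ⟨_, hc.comp_clamp hγ.qhLength_nonneg, ?_, ?_⟩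
  · simp only [clamp_zero hγ.qhLength_nonneg, h0]
  · simp only [clamp_of_le hγ.qhLength_nonneg hlt.le, h1]

theorem norm_sub_le_qhDist (hΩ : IsProperConvexDomain Ω) (hx : x ∈ Ω) (hy : y ∈ Ω) :
    ‖y - x‖ ≤ bdryDist Ω x * (Real.exp (qhDist Ω x y) - 1) := by
  have hlim : Tendsto (fun R => bdryDist Ω x * (Real.exp R - 1)) (𝓝[>] (qhDist Ω x y))
      (𝓝 (bdryDist Ω x * (Real.exp (qhDist Ω x y) - 1))) := by
    refine Tendsto.mono_left (Continuous.tendsto ?_ _) nhdsWithin_le_nhds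
    fun_prop
  refine ge_of_tendsto hlim (eventually_nhdsWithin_of_forall fun R hR => ?_)
  obtain ⟨γ, hγ, h0, h1⟩ := hΩ.exists_isQHCurve_of_lt hx hy hR
  have := hγ.norm_sub_le 0 R
  rwa [h0, h1, sub_zero, abs_of_pos ((qhDist_nonneg Ω x y).trans_lt hR)] at this

theorem qhDist_comm_le (hΩ : IsProperConvexDomain Ω) (hx : x ∈ Ω) (hy : y ∈ Ω) :
    qhDist Ω y x ≤ qhDist Ω x y := by
  refine le_of_forall_gt_imp_ge_of_dense fun R hR => ?_
  obtain ⟨γ, hγ, h0, h1⟩ := hΩ.exists_isQHCurve_of_lt hx hy hR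
  have := hγ.qhDist_le_abs hΩ R 0
  rwa [h0, h1, zero_sub, abs_neg, abs_of_pos ((qhDist_nonneg Ω x y).trans_lt hR)] at this

theorem qhDist_comm (hΩ : IsProperConvexDomain Ω) (hx : x ∈ Ω) (hy : y ∈ Ω) :
    qhDist Ω x y = qhDist Ω y x :=
  le_antisymm (hΩ.qhDist_comm_le hy hx) (hΩ.qhDist_comm_le hx hy)

theorem qhDist_triangle (hΩ : IsProperConvexDomain Ω) (hx : x ∈ Ω) (hy : y ∈ Ω) (hz : z ∈ Ω) :
    qhDist Ω x z ≤ qhDist Ω x y + qhDist Ω y z := by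
  refine le_of_forall_pos_le_add fun ε hε => ?_
  have h1 : qhDist Ω x y < qhDist Ω x y + ε / 2 := by linarith
  have h2 : qhDist Ω y z < qhDist Ω y z + ε / 2 := by linarith
  obtain ⟨γ₁, hγ₁, h10, h11⟩ := hΩ.exists_isQHCurve_of_lt hx hy h1
  obtain ⟨γ₂, hγ₂, h20, h21⟩ := hΩ.exists_isQHCurve_of_lt hy hz h2
  have hn1 := (qhDist_nonneg Ω x y).trans_lt h1
  have hn2 := (qhDist_nonneg Ω y z).trans_lt h2
  have := (hγ₁.concat hγ₂ _ (h11.trans h20.symm)).qhDist_le hΩ (add_pos hn1 hn2).le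
  rw [if_pos hn1.le, if_neg (by linarith), h10, add_sub_cancel_left, h21] at this
  linarith

theorem qhDist_le_div (hΩ : IsProperConvexDomain Ω) (hx : x ∈ Ω) (hy : y ∈ Ω) {c : ℝ}
    (hc : 0 < c) (hcx : c ≤ bdryDist Ω x) (hcy : c ≤ bdryDist Ω y) :
    qhDist Ω x y ≤ ‖x - y‖ / c := by
  obtain ⟨γ, hγ, h0, h1⟩ := hΩ.exists_isQHCurve_segment hx hy hc hcx hcy
  have := hγ.qhDist_le hΩ (R := ‖x - y‖ / c) (by positivity)
  rwa [h0, h1] at this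

/-- Sharp to first order as `y → x`; it turns lower bounds on quasihyperbolic speed into lower
bounds on norm speed. -/
theorem qhDist_le_div_sub (hΩ : IsProperConvexDomain Ω) (hx : x ∈ Ω) (hy : y ∈ Ω)
    (hxy : ‖x - y‖ < bdryDist Ω x) :
    qhDist Ω x y ≤ ‖x - y‖ / (bdryDist Ω x - ‖x - y‖) := by
  refine hΩ.qhDist_le_div hx hy (sub_pos.2 hxy) (by linarith [norm_nonneg (x - y)]) ?_
  linarith [bdryDist_le_add (Ω := Ω) x y]

theorem abs_qhDist_sub_le (hΩ : IsProperConvexDomain Ω) (hx : x ∈ Ω) (hy : y ∈ Ω) (hz : z ∈ Ω) :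
    |qhDist Ω x y - qhDist Ω x z| ≤ qhDist Ω y z := by
  have h1 := hΩ.qhDist_triangle hx hy hz
  have h2 := hΩ.qhDist_triangle hx hz hy
  rw [hΩ.qhDist_comm hz hy] at h2
  rw [abs_le]; constructor <;> linarith

theorem continuousAt_qhDist (hΩ : IsProperConvexDomain Ω) (hx : x ∈ Ω) (hy : y ∈ Ω) :
    ContinuousAt (qhDist Ω x) y := by
  have hd := hΩ.bdryDist_pos hy
  have hlim : Tendsto (fun z => ‖y - z‖ / (bdryDist Ω y - ‖y - z‖)) (𝓝 y) (𝓝 0) := by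
    have : ContinuousAt (fun z => ‖y - z‖ / (bdryDist Ω y - ‖y - z‖)) y :=
      ContinuousAt.div (by fun_prop) (by fun_prop) (by simpa using hd.ne')
    simpa [ContinuousAt] using this
  rw [ContinuousAt, tendsto_iff_norm_sub_tendsto_zero]
  refine squeeze_zero' (Eventually.of_forall fun _ => norm_nonneg _) ?_ hlim
  have hnear : ∀ᶠ z in 𝓝 y, ‖y - z‖ < bdryDist Ω y := by
    have : ContinuousAt (fun z => ‖y - z‖) y := by fun_prop
    exact this.eventually_lt continuousAt_const (by simpa using hd)
  filter_upwards [hnear, hΩ.isOpen.mem_nhds hy] with z hz hzΩ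
  rw [Real.norm_eq_abs, abs_sub_comm]
  exact (hΩ.abs_qhDist_sub_le hx hy hzΩ).trans (hΩ.qhDist_le_div_sub hy hzΩ hz)

end IsProperConvexDomain

/-- Concavity of `d` is exactly what the averaged speed bounds require. -/
theorem IsQHCurve.convex_comb (hΩ : IsProperConvexDomain Ω) {γ₁ γ₂ : ℝ → X}
    (h₁ : IsQHCurve Ω γ₁) (h₂ : IsQHCurve Ω γ₂) {a b : ℝ} (ha : 0 ≤ a) (hb : 0 ≤ b)
    (hab : a + b = 1) : IsQHCurve Ω fun t => a • γ₁ t + b • γ₂ t where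
  mem t := hΩ.convex (h₁.mem t) (h₂.mem t) ha hb hab
  norm_sub_le s t := by
    have h0 : 0 ≤ Real.exp |t - s| - 1 := sub_nonneg.2 (Real.one_le_exp (abs_nonneg _))
    calc ‖a • γ₁ t + b • γ₂ t - (a • γ₁ s + b • γ₂ s)‖
        = ‖a • (γ₁ t - γ₁ s) + b • (γ₂ t - γ₂ s)‖ := by congr 1; module
      _ ≤ a * ‖γ₁ t - γ₁ s‖ + b * ‖γ₂ t - γ₂ s‖ := by
        refine (norm_add_le _ _).trans_eq ?_
        rw [norm_smul, norm_smul, Real.norm_of_nonneg ha, Real.norm_of_nonneg hb]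
      _ ≤ a * (bdryDist Ω (γ₁ s) * (Real.exp |t - s| - 1)) +
          b * (bdryDist Ω (γ₂ s) * (Real.exp |t - s| - 1)) := by
        gcongr
        exacts [h₁.norm_sub_le s t, h₂.norm_sub_le s t]
      _ = (a * bdryDist Ω (γ₁ s) + b * bdryDist Ω (γ₂ s)) * (Real.exp |t - s| - 1) := by ring
      _ ≤ _ := by
        gcongr
        exact hΩ.bdryDist_concave (h₁.mem s) (h₂.mem s) ha hb hab

end Distance

/-! ### Weak limits along ultrafilters. -/

section Weak

variable {X : Type*} [NormedAddCommGroup X] [NormedSpace ℝ X] {ι : Type*}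

/-- Weak convergence of a family in a real normed space along a filter. -/
def TendstoWeakly (u : ι → X) (l : Filter ι) (x : X) : Prop :=
  ∀ f : StrongDual ℝ X, Tendsto (fun i => f (u i)) l (𝓝 (f x))

/-- Banach-Alaoglu in the bidual gives a limit, which reflexivity brings back to `X`. -/
theorem IsReflexiveSpace.exists_tendstoWeakly (hrefl : IsReflexiveSpace X) (l : Ultrafilter ι)
    {u : ι → X} {C : ℝ} (hu : ∀ᶠ i in l, ‖u i‖ ≤ C) : ∃ x, TendstoWeakly u l x := by
  let J : X → WeakDual ℝ (StrongDual ℝ X) := fun x =>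
    StrongDual.toWeakDual (NormedSpace.inclusionInDoubleDual ℝ X x)
  have hcomp := WeakDual.isCompact_closedBall (𝕜 := ℝ) (0 : StrongDual ℝ (StrongDual ℝ X)) C
  have hmem : ∀ᶠ i in l, J (u i) ∈ WeakDual.toStrongDual ⁻¹'
      Metric.closedBall (0 : StrongDual ℝ (StrongDual ℝ X)) C := by
    filter_upwards [hu] with i hi
    exact (mem_closedBall_zero_iff (E := StrongDual ℝ (StrongDual ℝ X))).2
      ((NormedSpace.double_dual_bound ℝ X (u i)).trans hi)
  obtain ⟨φ, -, hφ⟩ := hcomp.ultrafilter_le_nhds (l.map fun i => J (u i))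
    (by exact le_principal_iff.2 (Filter.mem_map.2 hmem))
  obtain ⟨x, hx⟩ := hrefl (WeakDual.toStrongDual φ)
  refine ⟨x, fun f => ?_⟩
  have h1 : Tendsto (fun i => J (u i)) l (𝓝 φ) := hφ
  have h2 := ((WeakDual.eval_continuous f).tendsto φ).comp h1
  have h3 : φ f = f x := by
    rw [← NormedSpace.dual_def ℝ X x f, hx]; rfl
  rw [h3] at h2
  exact h2

theorem TendstoWeakly.norm_le {u : ι → X} {l : Filter ι} [l.NeBot] {x : X}
    (h : TendstoWeakly u l x) {c : ι → ℝ} {C : ℝ} (hc : Tendsto c l (𝓝 C))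
    (hu : ∀ᶠ i in l, ‖u i‖ ≤ c i) : ‖x‖ ≤ C := by
  obtain ⟨f, hf, hfx⟩ := exists_dual_vector'' ℝ x
  have h1 := h f
  rw [hfx] at h1
  refine le_of_tendsto_of_tendsto h1 hc ?_
  filter_upwards [hu] with i hi
  calc f (u i) ≤ ‖f (u i)‖ := Real.le_norm_self _
    _ ≤ ‖f‖ * ‖u i‖ := f.le_opNorm _
    _ ≤ 1 * ‖u i‖ := by gcongr
    _ ≤ c i := by rwa [one_mul]

theorem TendstoWeakly.sub {u v : ι → X} {l : Filter ι} {x y : X} (hu : TendstoWeakly u l x)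
    (hv : TendstoWeakly v l y) : TendstoWeakly (fun i => u i - v i) l (x - y) := fun f => by
  simpa using (hu f).sub (hv f)

theorem Filter.Tendsto.tendstoWeakly {u : ι → X} {l : Filter ι} {x : X} (h : Tendsto u l (𝓝 x)) :
    TendstoWeakly u l x := fun f => (f.continuous.tendsto x).comp h

theorem TendstoWeakly.unique {u : ι → X} {l : Filter ι} [l.NeBot] {x y : X}
    (hx : TendstoWeakly u l x) (hy : TendstoWeakly u l y) : x = y := by
  have := (hx.sub hy).norm_le (c := fun _ => 0) tendsto_const_nhds
    (Eventually.of_forall fun i => by simp)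
  exact sub_eq_zero.1 (norm_le_zero_iff.1 this)

/-- Hahn-Banach separation: closed convex sets are weakly closed. -/
theorem TendstoWeakly.mem_of_isClosed {u : ι → X} {l : Filter ι} [l.NeBot] {x : X}
    (h : TendstoWeakly u l x) {s : Set X} (hs : Convex ℝ s) (hc : IsClosed s)
    (hu : ∀ᶠ i in l, u i ∈ s) : x ∈ s := by
  by_contra hx
  obtain ⟨f, c, hfx, hf⟩ := geometric_hahn_banach_point_closed hs hc hx
  have : c ≤ f x := ge_of_tendsto (h f) (hu.mono fun i hi => (hf _ hi).le)
  linarith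

end Weak

/-! ### Existence of geodesics. -/

section Geodesic

variable {X : Type*} [NormedAddCommGroup X] [NormedSpace ℝ X] {Ω : Set X}

theorem IsQHCurve.exists_tendstoWeakly (hΩ : IsProperConvexDomain Ω) (hrefl : IsReflexiveSpace X)
    {ι : Type*} (l : Ultrafilter ι) {x : X} {γ : ι → ℝ → X} (hγ : ∀ i, IsQHCurve Ω (γ i))
    (h0 : ∀ i, γ i 0 = x) :
    ∃ c : ℝ → X, IsQHCurve Ω c ∧ ∀ t, TendstoWeakly (fun i => γ i t) l (c t) := by
  have hbd : ∀ t i, ‖γ i t‖ ≤ ‖x‖ + bdryDist Ω x * (Real.exp |t| - 1) := by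
    intro t i
    have h1 := (hγ i).norm_sub_le 0 t
    rw [h0, sub_zero] at h1
    have h2 := norm_le_norm_add_norm_sub x (γ i t)
    rw [norm_sub_rev] at h2
    linarith
  choose c hc using fun t => hrefl.exists_tendstoWeakly l (Eventually.of_forall (hbd t))
  have hDmem : ∀ s i, bdryDist Ω (γ i s) ∈
      Icc (bdryDist Ω x * Real.exp (-|s|)) (bdryDist Ω x * Real.exp |s|) := by
    intro s i
    have h1 := (hγ i).bdryDist_le 0 s
    have h2 := (hγ i).bdryDist_le s 0
    rw [h0, sub_zero] at h1
    rw [h0, zero_sub, abs_neg] at h2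
    refine ⟨?_, h1⟩
    rwa [Real.exp_neg, ← div_eq_mul_inv, div_le_iff₀ (Real.exp_pos _)]
  have hD : ∀ s, ∃ D, bdryDist Ω x * Real.exp (-|s|) ≤ D ∧
      Tendsto (fun i => bdryDist Ω (γ i s)) l (𝓝 D) := by
    intro s
    obtain ⟨D, hD, hlim⟩ := isCompact_Icc.ultrafilter_le_nhds
      (l.map fun i => bdryDist Ω (γ i s))
      (by exact le_principal_iff.2 (Filter.mem_map.2 (univ_mem' (hDmem s))))
    exact ⟨D, hD.1, hlim⟩
  choose D hDle hDlim using hD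
  have hxpos : ∀ s, 0 < D s := by
    intro s
    obtain ⟨i⟩ : Nonempty ι := nonempty_of_neBot (l : Filter ι)
    have hx : x ∈ Ω := h0 i ▸ (hγ i).mem 0
    exact (mul_pos (hΩ.bdryDist_pos hx) (Real.exp_pos _)).trans_le (hDle s)
  -- The limit `D s` of the boundary distances is positive, and superlevel sets of `d` are weakly
  -- closed; so `c s` stays in `Ω` and `D s ≤ d(c s)`.
  have hmem : ∀ s, ∀ e, 0 < e → e < D s → c s ∈ {z | z ∈ Ω ∧ e ≤ bdryDist Ω z} := by
    intro s e he heD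
    refine (hc s).mem_of_isClosed (hΩ.convex_setOf_le_bdryDist e)
      (hΩ.isClosed_setOf_le_bdryDist he) ?_
    filter_upwards [(hDlim s).eventually (lt_mem_nhds heD)] with i hi
    exact ⟨(hγ i).mem s, hi.le⟩
  refine ⟨c, ⟨fun s => (hmem s (D s / 2) (half_pos (hxpos s)) (half_lt_self (hxpos s))).1,
    fun s t => ?_⟩, hc⟩
  have h1 : ‖c t - c s‖ ≤ D s * (Real.exp |t - s| - 1) :=
    ((hc t).sub (hc s)).norm_le ((hDlim s).mul_const _)
      (Eventually.of_forall fun i => (hγ i).norm_sub_le s t)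
  have h2 : D s ≤ bdryDist Ω (c s) := by
    refine le_of_forall_lt_imp_le_of_dense fun e he => ?_
    rcases le_or_gt e 0 with he0 | he0
    · exact he0.trans Metric.infDist_nonneg
    · exact (hmem s e he0 he).2
  refine h1.trans ?_
  have : 0 ≤ Real.exp |t - s| - 1 := sub_nonneg.2 (Real.one_le_exp (abs_nonneg _))
  gcongr

/-- Take a weak limit of curves arriving at time `R + 1 / (n + 1)`. Their positions at time `R`
converge to `y` in norm, which identifies the end point. -/
theorem IsProperConvexDomain.exists_geodesic (hΩ : IsProperConvexDomain Ω)
    (hrefl : IsReflexiveSpace X) {x y : X} (hx : x ∈ Ω) (hy : y ∈ Ω) :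
    ∃ γ : ℝ → X, IsQHCurve Ω γ ∧ γ 0 = x ∧ γ (qhDist Ω x y) = y := by
  set R := qhDist Ω x y with hR
  have hlt : ∀ n : ℕ, qhDist Ω x y < R + 1 / ((n : ℝ) + 1) := fun n =>
    lt_add_of_pos_right _ (by positivity)
  choose γ hγ h0 h1 using fun n => hΩ.exists_isQHCurve_of_lt hx hy (hlt n)
  obtain ⟨c, hc, hlim⟩ := IsQHCurve.exists_tendstoWeakly hΩ hrefl (hyperfilter ℕ) hγ h0
  have hle : (hyperfilter ℕ : Filter ℕ) ≤ atTop := by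
    rw [← Nat.cofinite_eq_atTop]; exact hyperfilter_le_cofinite
  refine ⟨c, hc, ?_, ?_⟩
  · refine (hlim 0).unique (Tendsto.tendstoWeakly ?_)
    simp only [h0]
    exact tendsto_const_nhds
  · refine (hlim R).unique (Tendsto.tendstoWeakly (Tendsto.mono_left ?_ hle))
    rw [tendsto_iff_norm_sub_tendsto_zero]
    have hz : Tendsto (fun n : ℕ => bdryDist Ω y * (Real.exp (1 / ((n : ℝ) + 1)) - 1)) atTop
        (𝓝 0) := by
      have h1 := (Real.continuous_exp.tendsto 0).comp (tendsto_one_div_add_atTop_nhds_zero_nat (𝕜 := ℝ))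
      have h2 := (h1.sub_const 1).const_mul (bdryDist Ω y)
      simpa using h2
    refine squeeze_zero (fun _ => norm_nonneg _) (fun n => ?_) hz
    have := (hγ n).norm_sub_le (R + 1 / ((n : ℝ) + 1)) R
    rwa [h1, sub_add_cancel_left, abs_neg, abs_of_nonneg (by positivity)] at this

end Geodesic

/-! ### Quantitative local uniform rotundity and the Kadets-Klee property. -/

section LUR

variable {X : Type*} [NormedAddCommGroup X] [NormedSpace ℝ X]

/-- Rescale by the inverse norm of the shorter vector and subtract the excess of the longer one. -/
theorem norm_inv_smul_add_inv_smul_ge {u v : X} (hu : u ≠ 0) (hv : v ≠ 0) {δ : ℝ}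
    (h : ‖u‖ + ‖v‖ - δ ≤ ‖u + v‖) :
    2 - δ / min ‖u‖ ‖v‖ ≤ ‖‖u‖⁻¹ • u + ‖v‖⁻¹ • v‖ := by
  have key : ∀ a b : X, a ≠ 0 → b ≠ 0 → ‖a‖ ≤ ‖b‖ → ‖a‖ + ‖b‖ - δ ≤ ‖a + b‖ →
      2 - δ / ‖a‖ ≤ ‖‖a‖⁻¹ • a + ‖b‖⁻¹ • b‖ := by
    intro a b ha hb hab hle
    have ha' := norm_pos_iff.2 ha
    have hb' := norm_pos_iff.2 hb
    have e1 : ‖a‖⁻¹ • (a + b) = (‖a‖⁻¹ • a + ‖b‖⁻¹ • b) + (‖a‖⁻¹ - ‖b‖⁻¹) • b := by module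
    have e2 : ‖a‖⁻¹ * ‖a + b‖ ≤ ‖‖a‖⁻¹ • a + ‖b‖⁻¹ • b‖ + (‖a‖⁻¹ - ‖b‖⁻¹) * ‖b‖ := by
      have := norm_add_le (‖a‖⁻¹ • a + ‖b‖⁻¹ • b) ((‖a‖⁻¹ - ‖b‖⁻¹) • b)
      rw [← e1, norm_smul, norm_smul, norm_inv, norm_norm, Real.norm_of_nonneg
        (sub_nonneg.2 (inv_anti₀ ha' hab))] at this
      exact this
    have e3 : ‖a‖⁻¹ * (‖a‖ + ‖b‖ - δ) ≤ ‖a‖⁻¹ * ‖a + b‖ := by gcongr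
    have e4 : ‖a‖⁻¹ * (‖a‖ + ‖b‖ - δ) - (‖a‖⁻¹ - ‖b‖⁻¹) * ‖b‖ = 2 - δ / ‖a‖ := by
      field_simp; ring
    linarith
  rcases le_total ‖u‖ ‖v‖ with huv | huv
  · rw [min_eq_left huv]; exact key u v hu hv huv h
  · rw [min_eq_right huv, add_comm (‖u‖⁻¹ • u)]
    exact key v u hv hu huv (by rwa [add_comm v u, add_comm ‖v‖])

/-- Rotundity at `u` against vectors of varying length: `δ` is uniform in `μ`, which later is the
boundary distance at a point of a varying curve. -/
theorem IsLURSpace.exists_delta (hX : IsLURSpace X) {u : X} (hu : u ≠ 0) {c C ε : ℝ} (hc : 0 < c)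
    (hε : 0 < ε) : ∃ δ > 0, ∀ μ : ℝ, c ≤ μ → μ ≤ C → ∀ v : X, ‖v‖ ≤ μ + δ →
      ‖u‖ + μ - δ ≤ ‖u + v‖ → ‖v - (μ / ‖u‖) • u‖ ≤ ε := by
  by_contra! hcon
  have hu' := norm_pos_iff.2 hu
  -- With `δ ≤ c / 2` the counterexamples satisfy `‖v n‖ ≥ c / 2` and can be normalized.
  have hδ : ∀ n : ℕ, 0 < c / 2 / ((n : ℝ) + 1) := fun n => by positivity
  choose μ hcμ hμC v hv huv hε' using fun n : ℕ => hcon _ (hδ n)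
  set δ : ℕ → ℝ := fun n => c / 2 / ((n : ℝ) + 1) with hδdef
  have hδlim : Tendsto δ atTop (𝓝 0) := by
    have := (tendsto_one_div_add_atTop_nhds_zero_nat (𝕜 := ℝ)).const_mul (c / 2)
    simpa [hδdef, div_eq_mul_inv] using this
  have hδle : ∀ n, δ n ≤ c / 2 := fun n =>
    div_le_self (by positivity) (by linarith [(Nat.cast_nonneg n : (0 : ℝ) ≤ n)])
  have hvlow : ∀ n, μ n - δ n ≤ ‖v n‖ := fun n => by
    have := norm_add_le u (v n); linarith [huv n]
  have hvc : ∀ n, c / 2 ≤ ‖v n‖ := fun n => by linarith [hvlow n, hcμ n, hδle n]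
  have hvpos : ∀ n, 0 < ‖v n‖ := fun n => by linarith [hvc n]
  have hx1 : ‖‖u‖⁻¹ • u‖ = 1 := by rw [norm_smul, norm_inv, norm_norm, inv_mul_cancel₀ hu'.ne']
  have hw1 : ∀ n, ‖‖v n‖⁻¹ • v n‖ = 1 := fun n => by
    rw [norm_smul, norm_inv, norm_norm, inv_mul_cancel₀ (hvpos n).ne']
  have hsum : ∀ n, 2 - 2 * δ n / min ‖u‖ (c / 2) ≤ ‖‖u‖⁻¹ • u + ‖v n‖⁻¹ • v n‖ := by
    intro n
    have h1 := norm_inv_smul_add_inv_smul_ge hu (norm_pos_iff.1 (hvpos n)) (δ := 2 * δ n)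
      (by linarith [huv n, hv n])
    refine le_trans ?_ h1
    have : min ‖u‖ (c / 2) ≤ min ‖u‖ ‖v n‖ := min_le_min_left _ (hvc n)
    have h0 : 0 < min ‖u‖ (c / 2) := lt_min hu' (by positivity)
    have := (hδ n).le
    gcongr
  have hlim : Tendsto (fun n => ‖(1 / 2 : ℝ) • (‖u‖⁻¹ • u + ‖v n‖⁻¹ • v n)‖) atTop (𝓝 1) := by
    have hl : Tendsto (fun n => (1 / 2 : ℝ) * (2 - 2 * δ n / min ‖u‖ (c / 2))) atTop (𝓝 1) := by
      have := (((hδlim.const_mul 2).div_const (min ‖u‖ (c / 2))).const_sub 2).const_mul (1 / 2 : ℝ)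
      simpa using this
    refine tendsto_of_tendsto_of_tendsto_of_le_of_le hl tendsto_const_nhds (fun n => ?_)
      fun n => ?_
    · rw [norm_smul, Real.norm_of_nonneg (by norm_num)]
      exact mul_le_mul_of_nonneg_left (hsum n) (by norm_num)
    · have := norm_add_le (‖u‖⁻¹ • u) (‖v n‖⁻¹ • v n)
      rw [hx1, hw1] at this
      rw [norm_smul, Real.norm_of_nonneg (show (0 : ℝ) ≤ 1 / 2 by norm_num)]
      linarith
  have hconv := hX (‖u‖⁻¹ • u) (fun n => ‖v n‖⁻¹ • v n) hx1 hw1 hlim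
  simp only at hconv
  have hbd : ∀ n, ε ≤ (C + c) * ‖‖v n‖⁻¹ • v n - ‖u‖⁻¹ • u‖ + δ n := by
    intro n
    have e1 : v n - (μ n / ‖u‖) • u =
        ‖v n‖ • (‖v n‖⁻¹ • v n - ‖u‖⁻¹ • u) + (‖v n‖ - μ n) • (‖u‖⁻¹ • u) := by
      rw [smul_sub, smul_inv_smul₀ (hvpos n).ne', div_eq_mul_inv]; module
    have e2 : |‖v n‖ - μ n| ≤ δ n := by
      rw [abs_le]; constructor <;> linarith [hvlow n, hv n]
    have e3 : ‖v n‖ ≤ C + c := by linarith [hv n, hμC n, hδle n]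
    calc ε ≤ ‖v n - (μ n / ‖u‖) • u‖ := (hε' n).le
      _ ≤ ‖v n‖ * ‖‖v n‖⁻¹ • v n - ‖u‖⁻¹ • u‖ + |‖v n‖ - μ n| * ‖‖u‖⁻¹ • u‖ := by
        rw [e1]
        refine (norm_add_le _ _).trans_eq ?_
        rw [norm_smul, norm_norm, norm_smul, Real.norm_eq_abs]
      _ ≤ _ := by
        rw [hx1, mul_one]
        gcongr
  have hz : Tendsto (fun n => (C + c) * ‖‖v n‖⁻¹ • v n - ‖u‖⁻¹ • u‖ + δ n) atTop (𝓝 0) := by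
    simpa using (hconv.const_mul (C + c)).add hδlim
  have := ge_of_tendsto' hz hbd
  linarith

/-- The Kadets-Klee property of locally uniformly rotund spaces. -/
theorem TendstoWeakly.tendsto_of_isLURSpace (hX : IsLURSpace X) {ι : Type*} {l : Filter ι}
    {q : ι → X} {u : X} (hq : TendstoWeakly q l u) (hu : u ≠ 0) {c : ι → ℝ}
    (hc : Tendsto c l (𝓝 ‖u‖)) (hqc : ∀ᶠ i in l, ‖q i‖ ≤ c i) : Tendsto q l (𝓝 u) := by
  have hu' := norm_pos_iff.2 hu
  rw [Metric.tendsto_nhds]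
  intro ε hε
  obtain ⟨δ, hδ, hδε⟩ := hX.exists_delta hu (C := ‖u‖) hu' (half_pos hε)
  obtain ⟨f, hf, hfu⟩ := exists_dual_vector'' ℝ u
  -- A norming functional of `u` keeps `‖u + q i‖` eventually above `2 * ‖u‖ - δ`.
  have h1 : Tendsto (fun i => f (u + q i)) l (𝓝 (‖u‖ + ‖u‖)) := by
    have := (hq f).const_add (f u)
    simpa [hfu] using this
  filter_upwards [hqc, hc.eventually (gt_mem_nhds (lt_add_of_pos_right _ hδ)),
    h1.eventually (lt_mem_nhds (sub_lt_self _ hδ))] with i hi1 hi2 hi3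
  have h2 : f (u + q i) ≤ ‖u + q i‖ := by
    calc f (u + q i) ≤ ‖f (u + q i)‖ := Real.le_norm_self _
      _ ≤ ‖f‖ * ‖u + q i‖ := f.le_opNorm _
      _ ≤ 1 * ‖u + q i‖ := by gcongr
      _ = _ := one_mul _
  have := hδε ‖u‖ le_rfl le_rfl (q i) (hi1.trans hi2.le) (hi3.le.trans h2)
  rw [div_self hu'.ne', one_smul] at this
  rw [dist_eq_norm]
  linarith

end LUR

/-! ### Strong derivatives of geodesics along an ultrafilter. -/

open MeasureTheory in
-- Glue the majorants over a partition into `n + 1` pieces: their integral is at most `R * ω (R / (n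
-- + 1))`, so their infimum over `n` vanishes a.e. Measurable majorants `e` replace `r`, which need
-- not be measurable.
theorem ae_nonpos_of_lintegral_Ioc_le {r ω : ℝ → ℝ} {R : ℝ} (hR : 0 < R)
    (hω : Tendsto ω (𝓝[>] 0) (𝓝 0))
    (h : ∀ s t, 0 ≤ s → s < t → t ≤ R → ∃ e : ℝ → ENNReal, Measurable e ∧
      (∀ᵐ p, p ∈ Ioc s t → ENNReal.ofReal (r p) ≤ e p) ∧
      ∫⁻ p in Ioc s t, e p ≤ ENNReal.ofReal (ω (t - s) * (t - s))) :
    ∀ᵐ p, p ∈ Ioc 0 R → r p ≤ 0 := by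
  have h' : ∀ s t, ∃ e : ℝ → ENNReal, Measurable e ∧ (0 ≤ s → s < t → t ≤ R →
      (∀ᵐ p, p ∈ Ioc s t → ENNReal.ofReal (r p) ≤ e p) ∧
      ∫⁻ p in Ioc s t, e p ≤ ENNReal.ofReal (ω (t - s) * (t - s))) := by
    intro s t
    by_cases hst : 0 ≤ s ∧ s < t ∧ t ≤ R
    · obtain ⟨e, he, he'⟩ := h s t hst.1 hst.2.1 hst.2.2
      exact ⟨e, he, fun _ _ _ => he'⟩
    · exact ⟨0, measurable_zero, fun h1 h2 h3 => absurd ⟨h1, h2, h3⟩ hst⟩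
  choose e hem he using h'
  set T : ℕ → ℕ → ℝ := fun n i => i * (R / ((n : ℝ) + 1)) with hT
  have hT0 : ∀ n i, 0 ≤ T n i := fun n i => by positivity
  have hTsub : ∀ n i, T n (i + 1) - T n i = R / ((n : ℝ) + 1) := fun n i => by
    simp only [hT]; push_cast; ring
  have hTlt : ∀ n i, T n i < T n (i + 1) := fun n i => by
    rw [← sub_pos, hTsub]; positivity
  have hTmono : ∀ n, Monotone (T n) := fun n => monotone_nat_of_le_succ fun i => (hTlt n i).le
  have hTend : ∀ n, T n (n + 1) = R := fun n => by simp only [hT]; push_cast; field_simp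
  have hTle : ∀ n, ∀ i ∈ Finset.range (n + 1), T n (i + 1) ≤ R := fun n i hi => by
    rw [← hTend n]; exact hTmono n (Nat.succ_le_of_lt (Finset.mem_range.1 hi))
  set E : ℕ → ℝ → ENNReal := fun n p => ∑ i ∈ Finset.range (n + 1),
    (Ioc (T n i) (T n (i + 1))).indicator (e (T n i) (T n (i + 1))) p with hE
  have hEm : ∀ n, Measurable (E n) := fun n =>
    Finset.measurable_fun_sum _ fun i _ => (hem _ _).indicator measurableSet_Ioc
  have hEint : ∀ n : ℕ, ∫⁻ p, E n p ≤ ENNReal.ofReal (R * ω (R / ((n : ℝ) + 1))) := by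
    intro n
    rw [lintegral_finsetSum _ fun i _ => (hem _ _).indicator measurableSet_Ioc]
    calc _ ≤ ∑ i ∈ Finset.range (n + 1),
          ENNReal.ofReal (ω (R / ((n : ℝ) + 1)) * (R / ((n : ℝ) + 1))) := by
          refine Finset.sum_le_sum fun i hi => ?_
          rw [lintegral_indicator measurableSet_Ioc, ← hTsub n i]
          exact (he _ _ (hT0 n i) (hTlt n i) (hTle n i hi)).2
      _ = _ := by
          rw [Finset.sum_const, Finset.card_range, nsmul_eq_mul, ← ENNReal.ofReal_natCast,
            ← ENNReal.ofReal_mul (by positivity)]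
          congr 1; push_cast; field_simp
  have hGint : ∫⁻ p, ⨅ n, E n p = 0 := by
    have hlim : Tendsto (fun n : ℕ => ENNReal.ofReal (R * ω (R / ((n : ℝ) + 1)))) atTop (𝓝 0) := by
      have h1 : Tendsto (fun n : ℕ => R / ((n : ℝ) + 1)) atTop (𝓝[>] 0) := by
        refine tendsto_nhdsWithin_iff.2 ⟨?_, Eventually.of_forall fun n => ?_⟩
        · have := (tendsto_one_div_add_atTop_nhds_zero_nat (𝕜 := ℝ)).const_mul R
          simpa [div_eq_mul_inv] using this
        · exact div_pos hR (by positivity)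
      have h2 := ENNReal.tendsto_ofReal ((hω.comp h1).const_mul R)
      simpa using h2
    refine le_antisymm (ge_of_tendsto' hlim fun n => ?_) zero_le
    exact (lintegral_mono fun p => iInf_le _ n).trans (hEint n)
  have hG0 := (lintegral_eq_zero_iff (Measurable.iInf hEm)).1 hGint
  have hae : ∀ᵐ p, ∀ n : ℕ, ∀ i ∈ Finset.range (n + 1), p ∈ Ioc (T n i) (T n (i + 1)) →
      ENNReal.ofReal (r p) ≤ e (T n i) (T n (i + 1)) p := by
    rw [ae_all_iff]; intro n
    rw [Finset.eventually_all]; intro i hi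
    exact (he _ _ (hT0 n i) (hTlt n i) (hTle n i hi)).1
  filter_upwards [hG0, hae] with p hp1 hp2 hpR
  rw [← ENNReal.ofReal_eq_zero, ← nonpos_iff_eq_zero]
  refine le_trans (le_iInf fun n => ?_) hp1.le
  have hU := (hTmono n).biUnion_Ico_Ioc_map_succ 0 (n + 1)
  have hp0 : p ∈ Ioc (T n 0) (T n (n + 1)) := by
    rw [hTend]; simpa [hT] using hpR
  rw [← hU] at hp0
  simp only [mem_iUnion] at hp0
  obtain ⟨i, hi, hpi⟩ := hp0
  have hi' : i ∈ Finset.range (n + 1) := Finset.mem_range.2 hi.2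
  refine (hp2 n i hi' hpi).trans ?_
  have := Finset.single_le_sum (f := fun i => (Ioc (T n i) (T n (i + 1))).indicator
    (e (T n i) (T n (i + 1))) p) (fun _ _ => zero_le) hi'
  refine le_trans ?_ this
  exact (indicator_of_mem (show p ∈ Ioc (T n i) (T n (i + 1)) from hpi) _).ge

theorem tendsto_inv_mul_exp_sub_one :
    Tendsto (fun h : ℝ => h⁻¹ * (Real.exp h - 1)) (𝓝[>] 0) (𝓝 1) := by
  have := (Real.hasDerivAt_exp 0).tendsto_slope_zero
  simp only [zero_add, Real.exp_zero, smul_eq_mul] at this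
  exact this.mono_left (nhdsWithin_mono _ fun x hx => ne_of_gt hx)

section Slope

variable {X : Type*} [NormedAddCommGroup X] {Ω : Set X} {γ : ℝ → X}

theorem IsQHCurve.norm_slope_le [NormedSpace ℝ X] (hγ : IsQHCurve Ω γ) (t : ℝ) {h : ℝ}
    (hh : 0 < h) :
    ‖h⁻¹ • (γ (t + h) - γ t)‖ ≤ bdryDist Ω (γ t) * (h⁻¹ * (Real.exp h - 1)) := by
  have := hγ.norm_sub_le t (t + h)
  rw [add_sub_cancel_left, abs_of_pos hh] at this
  rw [norm_smul, norm_inv, Real.norm_of_nonneg hh.le]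
  calc _ ≤ h⁻¹ * (bdryDist Ω (γ t) * (Real.exp h - 1)) := by gcongr
    _ = _ := by ring

variable [NormedSpace ℝ X]

/-- By the triangle inequality the curve is geodesic between `s` and `t` too; then solve `t - s ≤ N
/ (d - N)` for `N = ‖γ t - γ s‖`. -/
theorem IsQHCurve.le_norm_sub_of_qhDist_eq (hΩ : IsProperConvexDomain Ω) (hγ : IsQHCurve Ω γ)
    {R : ℝ} (hgeo : qhDist Ω (γ 0) (γ R) = R) {s t : ℝ} (hs : 0 ≤ s) (hst : s ≤ t) (ht : t ≤ R) :
    bdryDist Ω (γ s) * ((t - s) / (1 + (t - s))) ≤ ‖γ t - γ s‖ := by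
  have h1 := hΩ.qhDist_triangle (hγ.mem 0) (hγ.mem s) (hγ.mem R)
  have h2 := hΩ.qhDist_triangle (hγ.mem s) (hγ.mem t) (hγ.mem R)
  have h3 := hγ.qhDist_le_abs hΩ 0 s
  have h4 := hγ.qhDist_le_abs hΩ t R
  rw [sub_zero, abs_of_nonneg hs] at h3
  rw [abs_of_nonneg (sub_nonneg.2 ht)] at h4
  have hk : t - s ≤ qhDist Ω (γ s) (γ t) := by linarith
  have hh : 0 ≤ t - s := sub_nonneg.2 hst
  have hd := hΩ.bdryDist_pos (hγ.mem s)
  rw [← mul_div_assoc, div_le_iff₀ (by linarith)]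
  rcases lt_or_ge ‖γ s - γ t‖ (bdryDist Ω (γ s)) with hlt | hge
  · have h5 := hk.trans (hΩ.qhDist_le_div_sub (hγ.mem s) (hγ.mem t) hlt)
    rw [le_div_iff₀ (sub_pos.2 hlt), norm_sub_rev] at h5
    linarith
  · rw [norm_sub_rev] at hge
    nlinarith [norm_nonneg (γ t - γ s)]

open MeasureTheory in
/-- A quasihyperbolic geodesic of a reflexive LUR space has, along any ultrafilter of positive
step sizes, a strong derivative of maximal norm at almost every point. -/
theorem IsQHCurve.ae_tendsto_slope (hLUR : IsLURSpace X) (hrefl : IsReflexiveSpace X)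
    (hΩ : IsProperConvexDomain Ω) (hγ : IsQHCurve Ω γ) {R : ℝ} (hR : 0 < R)
    (hgeo : qhDist Ω (γ 0) (γ R) = R) (l : Ultrafilter ℝ) (hl : (l : Filter ℝ) ≤ 𝓝[>] 0) :
    ∀ᵐ t, t ∈ Ioc 0 R → ∃ u, ‖u‖ = bdryDist Ω (γ t) ∧
      Tendsto (fun h => h⁻¹ • (γ (t + h) - γ t)) l (𝓝 u) := by
  have hlpos : ∀ᶠ h in (l : Filter ℝ), 0 < h := hl self_mem_nhdsWithin
  have hslope : ∀ t, Tendsto (fun h : ℝ => bdryDist Ω (γ t) * (h⁻¹ * (Real.exp h - 1))) l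
      (𝓝 (bdryDist Ω (γ t))) := fun t => by
    simpa using (tendsto_inv_mul_exp_sub_one.mono_left hl).const_mul (bdryDist Ω (γ t))
  have hqle : ∀ t, ∀ᶠ h in (l : Filter ℝ), ‖h⁻¹ • (γ (t + h) - γ t)‖ ≤
      bdryDist Ω (γ t) * (h⁻¹ * (Real.exp h - 1)) := fun t =>
    hlpos.mono fun h hh => hγ.norm_slope_le t hh
  have hbd : ∀ t, ∀ᶠ h in (l : Filter ℝ), ‖h⁻¹ • (γ (t + h) - γ t)‖ ≤ bdryDist Ω (γ t) + 1 := by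
    intro t
    filter_upwards [hqle t, (hslope t).eventually (gt_mem_nhds (lt_add_one _))] with h h1 h2
    exact h1.trans h2.le
  -- Weak limits of difference quotients exist at every `t`, since `l` is an ultrafilter.
  choose u hu using fun t => hrefl.exists_tendstoWeakly l (hbd t)
  have hule : ∀ t, ‖u t‖ ≤ bdryDist Ω (γ t) := fun t => (hu t).norm_le (hslope t) (hqle t)
  have hdc : Continuous fun p => bdryDist Ω (γ p) :=
    (Metric.continuous_infDist_pt _).comp hγ.continuous
  set D := bdryDist Ω (γ 0) * Real.exp R with hD
  -- Let `f` norm the chord `γ t - γ s`. A.e. `(f ∘ γ)' ≤ ‖u‖`, so `d - (f ∘ γ)'` majorizes the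
  -- deficit `d - ‖u‖`. With `h = t - s`, its integral is at most `d(γ s) * h * e^h` minus the chord
  -- length, and the chord is at least `d(γ s) * h / (1 + h)`; this gives `ω`.
  have hkey : ∀ᵐ t, t ∈ Ioc 0 R → bdryDist Ω (γ t) - ‖u t‖ ≤ 0 := by
    refine ae_nonpos_of_lintegral_Ioc_le (ω := fun h => D * (Real.exp h - 1 / (1 + h))) hR ?_ ?_
    · have : ContinuousAt (fun h : ℝ => D * (Real.exp h - 1 / (1 + h))) 0 := by
        refine continuousAt_const.mul (Real.continuous_exp.continuousAt.sub ?_)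
        exact continuousAt_const.div (by fun_prop) (by norm_num)
      have h2 : Tendsto (fun h : ℝ => D * (Real.exp h - 1 / (1 + h))) (𝓝 0) (𝓝 0) := by
        simpa [ContinuousAt] using this
      exact h2.mono_left nhdsWithin_le_nhds
    intro s t hs hst ht
    obtain ⟨f, hf, hft⟩ := exists_dual_vector'' ℝ (γ t - γ s)
    have hac : AbsolutelyContinuousOnInterval (fun p => f (γ p)) s t := by
      refine LipschitzOnWith.absolutelyContinuousOnInterval
        (K := ‖f‖₊ * Real.toNNReal (bdryDist Ω (γ s) * Real.exp (2 * (t - s)))) ?_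
      rw [uIcc_of_le hst.le]
      exact f.lipschitz.comp_lipschitzOnWith (hγ.lipschitzOnWith s t)
    have hfu : ∀ p, DifferentiableAt ℝ (fun p => f (γ p)) p →
        deriv (fun p => f (γ p)) p ≤ ‖u p‖ := by
      intro p hp
      have h1 := hp.hasDerivAt.tendsto_slope_zero.mono_left
        (hl.trans (nhdsWithin_mono _ fun x (hx : (0 : ℝ) < x) => ne_of_gt hx))
      have h2 := hu p f
      simp only [map_smul, map_sub] at h2
      rw [tendsto_nhds_unique h1 h2]
      calc f (u p) ≤ ‖f (u p)‖ := Real.le_norm_self _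
        _ ≤ ‖f‖ * ‖u p‖ := f.le_opNorm _
        _ ≤ 1 * ‖u p‖ := by gcongr
        _ = _ := one_mul _
    have hdiff : ∀ᵐ p, p ∈ Ioc s t → DifferentiableAt ℝ (fun p => f (γ p)) p := by
      filter_upwards [hac.ae_differentiableAt] with p hp hpst
      exact hp (by rw [uIcc_of_le hst.le]; exact Ioc_subset_Icc_self hpst)
    refine ⟨fun p => ENNReal.ofReal (bdryDist Ω (γ p) - deriv (fun p => f (γ p)) p), ?_, ?_, ?_⟩
    · exact (hdc.measurable.sub (measurable_deriv _)).ennreal_ofReal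
    · filter_upwards [hdiff] with p hp hpst
      exact ENNReal.ofReal_le_ofReal (by linarith [hfu p (hp hpst)])
    · have hi1 : IntervalIntegrable (fun p => bdryDist Ω (γ p)) volume s t :=
        hdc.intervalIntegrable _ _
      have hi2 := hac.intervalIntegrable_deriv
      have hi := hi1.sub hi2
      rw [intervalIntegrable_iff_integrableOn_Ioc_of_le hst.le] at hi
      have hnn : 0 ≤ᵐ[volume.restrict (Ioc s t)]
          fun p => bdryDist Ω (γ p) - deriv (fun p => f (γ p)) p := by
        rw [EventuallyLE, ae_restrict_iff' measurableSet_Ioc]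
        filter_upwards [hdiff] with p hp hpst
        have := hfu p (hp hpst)
        simp only [Pi.zero_apply]
        linarith [hule p]
      rw [← ofReal_integral_eq_lintegral_ofReal hi hnn]
      refine ENNReal.ofReal_le_ofReal ?_
      rw [← intervalIntegral.integral_of_le hst.le, intervalIntegral.integral_sub hi1 hi2,
        hac.integral_deriv_eq_sub, ← map_sub, hft]
      simp only [RCLike.ofReal_real_eq_id, id_eq]
      have h1 : ∫ p in s..t, bdryDist Ω (γ p) ≤
          (t - s) * (bdryDist Ω (γ s) * Real.exp (t - s)) := by
        calc _ ≤ ∫ _ in s..t, bdryDist Ω (γ s) * Real.exp (t - s) := by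
              refine intervalIntegral.integral_mono_on hst.le hi1 intervalIntegrable_const
                fun p hp => (hγ.bdryDist_le s p).trans ?_
              have hd : 0 ≤ bdryDist Ω (γ s) := Metric.infDist_nonneg
              rw [abs_of_nonneg (sub_nonneg.2 hp.1)]
              gcongr; exact hp.2
          _ = _ := by rw [intervalIntegral.integral_const, smul_eq_mul]
      have h2 := hγ.le_norm_sub_of_qhDist_eq hΩ hgeo hs hst.le ht
      have h3 : bdryDist Ω (γ s) ≤ D := by
        have := hγ.bdryDist_le 0 s
        rw [sub_zero, abs_of_nonneg hs] at this
        refine this.trans ?_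
        have hd : 0 ≤ bdryDist Ω (γ 0) := Metric.infDist_nonneg
        rw [hD]; gcongr; linarith
      have h4 : 0 ≤ Real.exp (t - s) - 1 / (1 + (t - s)) := by
        rw [sub_nonneg]
        refine le_trans ?_ (Real.one_le_exp (sub_nonneg.2 hst.le))
        rw [div_le_one (by linarith)]; linarith
      have h5 : 0 ≤ t - s := sub_nonneg.2 hst.le
      calc _ ≤ (t - s) * (bdryDist Ω (γ s) * Real.exp (t - s)) -
            bdryDist Ω (γ s) * ((t - s) / (1 + (t - s))) := sub_le_sub h1 h2
        _ = bdryDist Ω (γ s) * (Real.exp (t - s) - 1 / (1 + (t - s))) * (t - s) := by ring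
        _ ≤ _ := by gcongr
  filter_upwards [hkey] with t ht htR
  have hnorm : ‖u t‖ = bdryDist Ω (γ t) := le_antisymm (hule t) (sub_nonpos.1 (ht htR))
  have hpos := hΩ.bdryDist_pos (hγ.mem t)
  -- The quotients have norms bounded by a quantity tending to `‖u t‖`, so Kadets-Klee applies.
  refine ⟨u t, hnorm, (hu t).tendsto_of_isLURSpace hLUR ?_ ?_ (hqle t)⟩
  · rw [← norm_pos_iff, hnorm]; exact hpos
  · rw [hnorm]; exact hslope t

end Slope

theorem IsQHCurve.bdryDist_mem_Icc {X : Type*} [NormedAddCommGroup X] {Ω : Set X} {γ : ℝ → X} (hγ : IsQHCurve Ω γ) {t R : ℝ}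
    (ht : t ∈ Icc 0 R) : bdryDist Ω (γ t) ∈
      Icc (bdryDist Ω (γ 0) * Real.exp (-R)) (bdryDist Ω (γ 0) * Real.exp R) := by
  have h1 := hγ.bdryDist_le 0 t
  have h2 := hγ.bdryDist_le t 0
  rw [sub_zero, abs_of_nonneg ht.1] at h1
  rw [zero_sub, abs_neg, abs_of_nonneg ht.1] at h2
  have hd : 0 ≤ bdryDist Ω (γ 0) := Metric.infDist_nonneg
  have hd' : 0 ≤ bdryDist Ω (γ t) := Metric.infDist_nonneg
  constructor
  · rw [Real.exp_neg, ← div_eq_mul_inv, div_le_iff₀ (Real.exp_pos _)]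
    refine h2.trans ?_
    gcongr; exact ht.2
  · refine h1.trans ?_
    gcongr; exact ht.2

/-! ### Rotundity of quasihyperbolic spheres. -/

section LocallyUniformlyRotund

variable {X : Type*} [NormedAddCommGroup X] [NormedSpace ℝ X] {Ω : Set X}

theorem IsQHCurve.midpoint (hΩ : IsProperConvexDomain Ω) {γ c : ℝ → X} (hγ : IsQHCurve Ω γ)
    (hc : IsQHCurve Ω c) : IsQHCurve Ω fun t => (1 / 2 : ℝ) • (γ t + c t) := by
  have := hγ.convex_comb hΩ hc (a := 1 / 2) (b := 1 / 2) (by norm_num) (by norm_num) (by norm_num)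
  simpa only [smul_add] using this

/-- The infinitesimal step. If the midpoint curve recedes from `γ 0` at rate nearly `1`, the slopes
of `γ` and `c` add up to nearly maximal norm, hence are nearly parallel. `δ` does not depend on `c`.
-/
theorem IsQHCurve.exists_delta_deriv_norm_sub_le (hLUR : IsLURSpace X)
    (hΩ : IsProperConvexDomain Ω) {γ : ℝ → X} (hγ : IsQHCurve Ω γ) {R t : ℝ} (ht : t ∈ Ioc 0 R)
    {l : Filter ℝ} [l.NeBot] (hl : l ≤ 𝓝[>] 0) {u : X} (hu : ‖u‖ = bdryDist Ω (γ t))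
    (hslope : Tendsto (fun h => h⁻¹ • (γ (t + h) - γ t)) l (𝓝 u)) {ε : ℝ} (hε : 0 < ε) :
    ∃ δ > 0, ∀ c : ℝ → X, IsQHCurve Ω c → c 0 = γ 0 → ∀ K' E' : ℝ,
      HasDerivAt (fun s => qhDist Ω (γ 0) ((1 / 2 : ℝ) • (γ s + c s))) K' t →
      HasDerivAt (fun s => ‖c s - γ s‖) E' t → 1 - δ ≤ K' → E' ≤ ‖c t - γ t‖ + ε := by
  have htI : t ∈ Icc 0 R := Ioc_subset_Icc_self ht
  have hd0 := hΩ.bdryDist_pos (hγ.mem 0)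
  have hd := hΩ.bdryDist_pos (hγ.mem t)
  set d := bdryDist Ω (γ t) with hd_def
  set C := bdryDist Ω (γ 0) * Real.exp R with hC_def
  have hC : 0 < C := mul_pos hd0 (Real.exp_pos _)
  have hune : u ≠ 0 := by rw [← norm_pos_iff, hu]; exact hd
  obtain ⟨δ₀, hδ₀, hδ⟩ := hLUR.exists_delta hune (c := bdryDist Ω (γ 0) * Real.exp (-R)) (C := C)
    (mul_pos hd0 (Real.exp_pos _)) (half_pos hε)
  -- The `1` keeps `1 - δ` nonnegative; the other bound gives `δ * (d + dn) ≤ δ₀ / 2`, as `dn ≤ C`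
  -- for every `c`.
  refine ⟨min 1 (δ₀ / (2 * (d + C))), lt_min one_pos (by positivity), ?_⟩
  intro c hc hc0 K' E' hK hE hK'
  have hη := hγ.midpoint hΩ hc
  set η : ℝ → X := fun s => (1 / 2 : ℝ) • (γ s + c s) with hη_def
  have hdn_mem := hc.bdryDist_mem_Icc htI
  rw [hc0] at hdn_mem
  have hdn := hΩ.bdryDist_pos (hc.mem t)
  set dn := bdryDist Ω (c t) with hdn_def
  have hdη : (d + dn) / 2 ≤ bdryDist Ω (η t) := by
    have := hΩ.bdryDist_concave (hγ.mem t) (hc.mem t) (a := 1 / 2) (b := 1 / 2) (by norm_num)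
      (by norm_num) (by norm_num)
    rw [← smul_add] at this
    refine le_trans (le_of_eq ?_) this
    ring
  have hdηpos := hΩ.bdryDist_pos (hη.mem t)
  have hlne : l ≤ 𝓝[≠] 0 := hl.trans (nhdsWithin_mono _ fun x (hx : (0 : ℝ) < x) => ne_of_gt hx)
  have hl0 : l ≤ 𝓝 0 := hl.trans nhdsWithin_le_nhds
  have hlpos : ∀ᶠ h in l, 0 < h := hl self_mem_nhdsWithin
  have hκ := hK.tendsto_slope_zero.mono_left hlne
  have hΔ : Tendsto (fun h => ‖η (t + h) - η t‖) l (𝓝 0) := by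
    have : Continuous fun h => ‖η (t + h) - η t‖ :=
      ((hη.continuous.comp (continuous_const.add continuous_id)).sub continuous_const).norm
    have h2 := this.tendsto 0
    simp only [add_zero, sub_self, norm_zero] at h2
    exact h2.mono_left hl0
  have hlim := hκ.mul (hΔ.const_sub (bdryDist Ω (η t)))
  rw [sub_zero] at hlim
  have hKd : (d + dn) / 2 - δ₀ / 4 ≤ K' * bdryDist Ω (η t) := by
    set δ := min 1 (δ₀ / (2 * (d + C)))
    have e1 : δ ≤ 1 := min_le_left _ _
    have e2 : δ * (d + dn) ≤ δ₀ / 2 := by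
      have : δ ≤ δ₀ / (2 * (d + C)) := min_le_right _ _
      calc δ * (d + dn) ≤ δ₀ / (2 * (d + C)) * (d + C) := by
            gcongr; exact hdn_mem.2
        _ = _ := by field_simp
    calc (d + dn) / 2 - δ₀ / 4 ≤ (1 - δ) * ((d + dn) / 2) := by linarith
      _ ≤ (1 - δ) * bdryDist Ω (η t) := by
        gcongr
      _ ≤ _ := by gcongr
  have hcslope : ∀ᶠ h in l, ‖h⁻¹ • (c (t + h) - c t)‖ ≤ dn + δ₀ := by
    have h1 : Tendsto (fun h : ℝ => dn * (h⁻¹ * (Real.exp h - 1))) l (𝓝 dn) := by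
      simpa using (tendsto_inv_mul_exp_sub_one.mono_left hl).const_mul dn
    filter_upwards [hlpos, h1.eventually (gt_mem_nhds (lt_add_of_pos_right _ hδ₀))] with h hh hh2
    exact (hc.norm_slope_le t hh).trans hh2.le
  have hclose : ∀ᶠ h in l, ‖h⁻¹ • (c (t + h) - c t) - (dn / d) • u‖ ≤ ε / 2 := by
    have hq : Tendsto (fun h => ‖h⁻¹ • (γ (t + h) - γ t) - u‖) l (𝓝 0) :=
      tendsto_iff_norm_sub_tendsto_zero.1 hslope
    -- The loss in `‖u + c-slope‖ ≥ d + dn - δ₀` is `δ₀ / 2` from `K'`, `δ₀ / 4` from the limit, and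
    -- `δ₀ / 4` from replacing the slope of `γ` by `u`.
    filter_upwards [hcslope, hlpos, hΔ.eventually (gt_mem_nhds hdηpos),
      hq.eventually (gt_mem_nhds (show (0 : ℝ) < δ₀ / 4 by positivity)),
      hlim.eventually (lt_mem_nhds (show (d + dn) / 2 - 3 * δ₀ / 8 < K' * bdryDist Ω (η t) by
        linarith))] with h h1 h2 h3 h4 h5
    have h6 : ‖η (t + h) - η t‖ = h / 2 *
        ‖h⁻¹ • (γ (t + h) - γ t) + h⁻¹ • (c (t + h) - c t)‖ := by
      have : η (t + h) - η t =
          (h / 2) • (h⁻¹ • (γ (t + h) - γ t) + h⁻¹ • (c (t + h) - c t)) := by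
        simp only [hη_def]
        rw [← smul_add, smul_smul, div_mul_eq_mul_div, mul_inv_cancel₀ h2.ne']
        module
      rw [this, norm_smul, Real.norm_of_nonneg (by positivity)]
    have h7 : qhDist Ω (γ 0) (η (t + h)) - qhDist Ω (γ 0) (η t) ≤
        ‖η (t + h) - η t‖ / (bdryDist Ω (η t) - ‖η (t + h) - η t‖) := by
      have e1 := hΩ.qhDist_triangle (hγ.mem 0) (hη.mem t) (hη.mem (t + h))
      have e2 := hΩ.qhDist_le_div_sub (hη.mem t) (hη.mem (t + h)) (by rwa [norm_sub_rev])
      rw [norm_sub_rev] at e2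
      linarith
    rw [le_div_iff₀ (sub_pos.2 h3)] at h7
    have h8 : h⁻¹ • (qhDist Ω (γ 0) (η (t + h)) - qhDist Ω (γ 0) (η t)) *
        (bdryDist Ω (η t) - ‖η (t + h) - η t‖) ≤
        1 / 2 * ‖h⁻¹ • (γ (t + h) - γ t) + h⁻¹ • (c (t + h) - c t)‖ := by
      rw [smul_eq_mul, mul_assoc]
      calc _ ≤ h⁻¹ * ‖η (t + h) - η t‖ := by gcongr
        _ = _ := by rw [h6]; field_simp
    have h9 : ‖h⁻¹ • (γ (t + h) - γ t) + h⁻¹ • (c (t + h) - c t)‖ ≤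
        ‖u + h⁻¹ • (c (t + h) - c t)‖ + ‖h⁻¹ • (γ (t + h) - γ t) - u‖ := by
      refine le_trans (le_of_eq ?_) (norm_add_le _ _)
      congr 1; abel
    have := hδ dn hdn_mem.1 hdn_mem.2 _ h1 (by rw [hu]; linarith)
    rwa [hu] at this
  have hEs := hE.tendsto_slope_zero.mono_left hlne
  have hbound : Tendsto (fun h => ε / 2 + ‖c t - γ t‖ + ‖h⁻¹ • (γ (t + h) - γ t) - u‖) l
      (𝓝 (ε / 2 + ‖c t - γ t‖ + 0)) :=
    (tendsto_iff_norm_sub_tendsto_zero.1 hslope).const_add _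
  have hfin : E' ≤ ε / 2 + ‖c t - γ t‖ + 0 := by
    refine le_of_tendsto_of_tendsto hEs hbound ?_
    filter_upwards [hclose, hlpos] with h h1 h2
    have e1 : ‖c (t + h) - γ (t + h)‖ - ‖c t - γ t‖ ≤
        ‖(c (t + h) - c t) - (γ (t + h) - γ t)‖ := by
      refine (norm_sub_norm_le _ _).trans (le_of_eq ?_)
      congr 1; abel
    have e2 : h⁻¹ * ‖(c (t + h) - c t) - (γ (t + h) - γ t)‖ =
        ‖h⁻¹ • (c (t + h) - c t) - h⁻¹ • (γ (t + h) - γ t)‖ := by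
      rw [← smul_sub, norm_smul, norm_inv, Real.norm_of_nonneg h2.le]
    have e3 : h⁻¹ • (c (t + h) - c t) - h⁻¹ • (γ (t + h) - γ t) =
        (h⁻¹ • (c (t + h) - c t) - (dn / d) • u) + (dn / d - 1) • u -
          (h⁻¹ • (γ (t + h) - γ t) - u) := by module
    -- Parallel slopes differ only in length, by `|dn - d|`, and `d` is 1-Lipschitz.
    have e4 : ‖(dn / d - 1) • u‖ ≤ ‖c t - γ t‖ := by
      rw [norm_smul, hu, Real.norm_eq_abs, ← abs_of_pos hd, ← abs_mul, abs_of_pos hd]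
      have : (dn / d - 1) * d = dn - d := by field_simp
      rw [this]
      exact abs_bdryDist_sub_le _ _
    calc h⁻¹ • (‖c (t + h) - γ (t + h)‖ - ‖c t - γ t‖) ≤
          h⁻¹ * ‖(c (t + h) - c t) - (γ (t + h) - γ t)‖ := by rw [smul_eq_mul]; gcongr
      _ ≤ ‖h⁻¹ • (c (t + h) - c t) - (dn / d) • u‖ + ‖(dn / d - 1) • u‖ +
          ‖h⁻¹ • (γ (t + h) - γ t) - u‖ := by
        rw [e2, e3]
        exact (_root_.norm_sub_le _ _).trans (by gcongr; exact norm_add_le _ _)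
      _ ≤ _ := by linarith
  linarith

open MeasureTheory in
theorem exists_subseq_tendsto_of_tendsto_qhDist_midpoint (hLUR : IsLURSpace X)
    (hrefl : IsReflexiveSpace X) (hΩ : IsProperConvexDomain Ω) {x₀ y : X} {u : ℕ → X}
    (hx₀ : x₀ ∈ Ω) (hy : y ∈ Ω) (hu : ∀ n, u n ∈ Ω) (hR : 0 < qhDist Ω x₀ y)
    (heq : ∀ n, qhDist Ω x₀ (u n) = qhDist Ω x₀ y)
    (hlim : Tendsto (fun n => qhDist Ω x₀ ((1 / 2 : ℝ) • (y + u n))) atTop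
      (𝓝 (qhDist Ω x₀ y))) :
    ∃ φ : ℕ → ℕ, Tendsto (fun n => u (φ n)) atTop (𝓝 y) := by
  obtain ⟨γ, hγ, hγ0, hγR⟩ := hΩ.exists_geodesic hrefl hx₀ hy
  choose c hc hc0 hcR using fun n => hΩ.exists_geodesic hrefl hx₀ (hu n)
  simp only [heq] at hcR
  set R := qhDist Ω x₀ y with hRdef
  have hη := fun n => hγ.midpoint hΩ (hc n)
  set K : ℕ → ℝ → ℝ := fun n s => qhDist Ω x₀ ((1 / 2 : ℝ) • (γ s + c n s)) with hK
  set E : ℕ → ℝ → ℝ := fun n s => ‖c n s - γ s‖ with hE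
  have hKlip : ∀ n, LipschitzWith 1 (K n) := fun n => by
    refine LipschitzWith.of_dist_le_mul fun s t => ?_
    rw [NNReal.coe_one, one_mul, Real.dist_eq, Real.dist_eq]
    exact (hΩ.abs_qhDist_sub_le hx₀ ((hη n).mem s) ((hη n).mem t)).trans
      (by rw [abs_sub_comm]; exact (hη n).qhDist_le_abs hΩ s t)
  have hKac : ∀ n, AbsolutelyContinuousOnInterval (K n) 0 R := fun n =>
    (hKlip n).lipschitzOnWith.absolutelyContinuousOnInterval
  -- The interval is extended to `R + 1` so that `R` has a neighbourhood on which the Lipschitz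
  -- bound controls the derivative.
  set B := bdryDist Ω x₀ * Real.exp (2 * (R + 1 - 0)) with hB
  have hElip : ∀ n, LipschitzOnWith (Real.toNNReal (2 * B)) (E n) (Icc 0 (R + 1)) := fun n => by
    refine LipschitzOnWith.of_dist_le_mul fun s hs t ht => ?_
    have hB0 : 0 ≤ B := mul_nonneg Metric.infDist_nonneg (Real.exp_pos _).le
    rw [Real.coe_toNNReal _ (by positivity), Real.dist_eq, Real.dist_eq]
    have h1 := hγ.norm_sub_le_mul hs ht
    have h2 := (hc n).norm_sub_le_mul hs ht
    rw [hγ0] at h1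
    rw [hc0] at h2
    calc |‖c n s - γ s‖ - ‖c n t - γ t‖| ≤ ‖(c n s - γ s) - (c n t - γ t)‖ :=
          abs_norm_sub_norm_le _ _
      _ = ‖(c n s - c n t) - (γ s - γ t)‖ := by congr 1; abel
      _ ≤ ‖c n s - c n t‖ + ‖γ s - γ t‖ := norm_sub_le _ _
      _ ≤ _ := by linarith
  have hEac : ∀ n, AbsolutelyContinuousOnInterval (E n) 0 R := fun n => by
    refine ((hElip n).mono ?_).absolutelyContinuousOnInterval
    rw [uIcc_of_le hR.le]; exact Icc_subset_Icc_right (by linarith)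
  have hK0 : ∀ n, K n 0 = 0 := fun n => by
    have h1 := hΩ.qhDist_le_div hx₀ hx₀ (hΩ.bdryDist_pos hx₀) le_rfl le_rfl
    rw [sub_self, norm_zero, zero_div] at h1
    have h2 : (1 / 2 : ℝ) • (γ 0 + c n 0) = x₀ := by rw [hγ0, hc0]; module
    simp only [hK, h2]
    exact le_antisymm h1 (qhDist_nonneg _ _ _)
  have hKR : Tendsto (fun n => R - K n R) atTop (𝓝 0) := by
    have : ∀ n, K n R = qhDist Ω x₀ ((1 / 2 : ℝ) • (y + u n)) := fun n => by
      simp only [hK, hγR, hcR]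
    simp only [this]
    simpa using hlim.const_sub R
  have hKd : ∀ n t, deriv (K n) t ≤ 1 := fun n t => by
    have := norm_deriv_le_of_lipschitz (hKlip n) (x₀ := t)
    rw [NNReal.coe_one] at this
    exact (Real.le_norm_self _).trans this
  set ν : Measure ℝ := volume.restrict (Ioc 0 R) with hν
  -- The nonnegative deficit `1 - K n'` has integral `R - K n R → 0`; convergence in `L¹` gives a.e.
  -- convergence of a subsequence.
  have hint : ∀ n, ∫ t in Ioc 0 R, (1 - deriv (K n) t) = R - K n R := fun n => by
    rw [← intervalIntegral.integral_of_le hR.le, intervalIntegral.integral_sub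
      intervalIntegrable_const (hKac n).intervalIntegrable_deriv, (hKac n).integral_deriv_eq_sub,
      hK0]
    simp
  have hKi : ∀ n, Integrable (fun t => 1 - deriv (K n) t) ν := fun n => by
    have := (intervalIntegrable_const (c := (1 : ℝ))).sub (hKac n).intervalIntegrable_deriv
    rwa [intervalIntegrable_iff_integrableOn_Ioc_of_le hR.le] at this
  have hL1 : Tendsto (fun n => eLpNorm ((fun t => 1 - deriv (K n) t) - fun _ => 0) 1 ν) atTop
      (𝓝 0) := by
    have : ∀ n, eLpNorm ((fun t => 1 - deriv (K n) t) - fun _ => 0) 1 ν =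
        ENNReal.ofReal (R - K n R) := fun n => by
      rw [eLpNorm_one_eq_lintegral_enorm, ← hint, ofReal_integral_eq_lintegral_ofReal (hKi n)
        (Eventually.of_forall fun t => sub_nonneg.2 (hKd n t))]
      refine lintegral_congr fun t => ?_
      rw [Pi.sub_apply, sub_zero, Real.enorm_of_nonneg (sub_nonneg.2 (hKd n t))]
    simp only [this]
    simpa using ENNReal.tendsto_ofReal hKR
  have hmeas := tendstoInMeasure_of_tendsto_eLpNorm one_ne_zero
    (fun n => (hKi n).aestronglyMeasurable) aestronglyMeasurable_const hL1
  obtain ⟨φ, -, hφ⟩ := hmeas.exists_seq_tendsto_ae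
  refine ⟨φ, ?_⟩
  let l : Ultrafilter ℝ := Ultrafilter.of (𝓝[>] 0)
  have hl : (l : Filter ℝ) ≤ 𝓝[>] 0 := Ultrafilter.of_le _
  have hgood := hγ.ae_tendsto_slope hLUR hrefl hΩ hR (by rw [hγ0, hγR]) l hl
  have hdiffK : ∀ᵐ t, ∀ n, t ∈ uIcc 0 R → DifferentiableAt ℝ (K n) t :=
    ae_all_iff.2 fun n => (hKac n).ae_differentiableAt
  have hdiffE : ∀ᵐ t, ∀ n, t ∈ uIcc 0 R → DifferentiableAt ℝ (E n) t :=
    ae_all_iff.2 fun n => (hEac n).ae_differentiableAt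
  have hpt : ∀ᵐ t ∂ν, Tendsto (fun n => max (deriv (E (φ n)) t - E (φ n) t) 0) atTop (𝓝 0) := by
    rw [hν, ae_restrict_iff' measurableSet_Ioc] at hφ ⊢
    filter_upwards [hφ, hgood, hdiffK, hdiffE] with t h1 h2 h3 h4 ht
    obtain ⟨w, hw, hslope⟩ := h2 ht
    have htu : t ∈ uIcc 0 R := by rw [uIcc_of_le hR.le]; exact Ioc_subset_Icc_self ht
    rw [Metric.tendsto_nhds]
    intro ε hε
    obtain ⟨δ, hδ, hδ'⟩ := hγ.exists_delta_deriv_norm_sub_le hLUR hΩ ht hl hw hslope (half_pos hε)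
    filter_upwards [(h1 ht).eventually (gt_mem_nhds hδ)] with n hn
    have := hδ' (c (φ n)) (hc _) (by rw [hc0, hγ0]) _ _
      (by rw [hγ0]; exact (h3 (φ n) htu).hasDerivAt) (h4 (φ n) htu).hasDerivAt (by linarith)
    rw [Real.dist_eq, sub_zero, abs_of_nonneg (le_max_right _ _)]
    refine max_lt ?_ hε
    simp only [hE] at this ⊢
    linarith
  have hEc : ∀ n, Continuous (E n) := fun n => ((hc n).continuous.sub hγ.continuous).norm
  have hDCT : Tendsto (fun n => ∫ t, max (deriv (E (φ n)) t - E (φ n) t) 0 ∂ν) atTop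
      (𝓝 (∫ _, (0 : ℝ) ∂ν)) := by
    refine tendsto_integral_of_dominated_convergence (fun _ => (Real.toNNReal (2 * B) : ℝ))
      (fun n => ?_) ?_ (fun n => ?_) hpt
    · exact (((measurable_deriv _).sub (hEc _).measurable).max
        measurable_const).aestronglyMeasurable
    · exact integrable_const _
    · rw [hν, ae_restrict_iff' measurableSet_Ioc]
      refine Eventually.of_forall fun t ht => ?_
      have h1 : ‖deriv (E (φ n)) t‖ ≤ Real.toNNReal (2 * B) :=
        norm_deriv_le_of_lipschitzOn (Icc_mem_nhds ht.1 (by linarith [ht.2])) (hElip (φ n))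
      rw [Real.norm_of_nonneg (le_max_right _ _)]
      refine max_le ?_ NNReal.zero_le_coe
      have h2 : 0 ≤ E (φ n) t := norm_nonneg _
      linarith [(Real.le_norm_self _).trans h1]
  rw [integral_zero] at hDCT
  have hexpac : AbsolutelyContinuousOnInterval (fun t : ℝ => Real.exp (-t)) 0 R := by
    refine ContDiffOn.absolutelyContinuousOnInterval ?_
    exact (Real.contDiff_exp.comp contDiff_neg).contDiffOn
  -- Grönwall: integrate `(e^{-t} E)' = e^{-t} (E' - E)` from `E 0 = 0`.
  have hfinal : ∀ n, Real.exp (-R) * E (φ n) R ≤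
      ∫ t, max (deriv (E (φ n)) t - E (φ n) t) 0 ∂ν := by
    intro n
    have hE0 : E (φ n) 0 = 0 := by simp only [hE, hc0, hγ0, sub_self, norm_zero]
    have hac := hexpac.mul (hEac (φ n))
    have hFTC : ∫ t in (0 : ℝ)..R, deriv (fun t => Real.exp (-t) * E (φ n) t) t =
        Real.exp (-R) * E (φ n) R - Real.exp (-0) * E (φ n) 0 := hac.integral_deriv_eq_sub
    rw [hE0, mul_zero, sub_zero] at hFTC
    rw [← hFTC, intervalIntegral.integral_of_le hR.le]
    refine integral_mono_ae ?_ ?_ ?_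
    · have := hac.intervalIntegrable_deriv
      rwa [intervalIntegrable_iff_integrableOn_Ioc_of_le hR.le] at this
    · have h1 := ((hEac (φ n)).intervalIntegrable_deriv.sub
        ((hEc (φ n)).intervalIntegrable 0 R))
      rw [intervalIntegrable_iff_integrableOn_Ioc_of_le hR.le] at h1
      exact h1.pos_part
    · rw [EventuallyLE, ae_restrict_iff' measurableSet_Ioc]
      filter_upwards [hdiffE] with t h4 ht
      have htu : t ∈ uIcc 0 R := by rw [uIcc_of_le hR.le]; exact Ioc_subset_Icc_self ht
      have hd := ((hasDerivAt_neg t).exp).mul (h4 (φ n) htu).hasDerivAt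
      have hd' : deriv (fun t => Real.exp (-t) * E (φ n) t) t =
          Real.exp (-t) * (deriv (E (φ n)) t - E (φ n) t) := by
        refine hd.deriv.trans ?_
        ring
      calc deriv (fun t => Real.exp (-t) * E (φ n) t) t =
            Real.exp (-t) * (deriv (E (φ n)) t - E (φ n) t) := hd'
        _ ≤ Real.exp (-t) * max (deriv (E (φ n)) t - E (φ n) t) 0 := by
          exact mul_le_mul_of_nonneg_left (le_max_left _ _) (Real.exp_pos _).le
        _ ≤ 1 * max (deriv (E (φ n)) t - E (φ n) t) 0 := by
          refine mul_le_mul_of_nonneg_right ?_ (le_max_right _ _)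
          rw [Real.exp_le_one_iff]; linarith [ht.1]
        _ = _ := one_mul _
  rw [tendsto_iff_norm_sub_tendsto_zero]
  have hz := hDCT.const_mul (Real.exp R)
  rw [mul_zero] at hz
  refine squeeze_zero (fun _ => norm_nonneg _) (fun n => ?_) hz
  have h1 : E (φ n) R = ‖u (φ n) - y‖ := by simp only [hE, hcR, hγR]
  have h2 := mul_le_mul_of_nonneg_left (hfinal n) (Real.exp_pos R).le
  rwa [← mul_assoc, ← Real.exp_add, add_neg_cancel, Real.exp_zero, one_mul, h1] at h2

theorem tendsto_of_tendsto_qhDist_midpoint (hLUR : IsLURSpace X)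
    (hrefl : IsReflexiveSpace X) (hΩ : IsProperConvexDomain Ω) {x₀ y : X} {u : ℕ → X}
    (hx₀ : x₀ ∈ Ω) (hy : y ∈ Ω) (hu : ∀ n, u n ∈ Ω)
    (heq : ∀ n, qhDist Ω x₀ (u n) = qhDist Ω x₀ y)
    (hlim : Tendsto (fun n => qhDist Ω x₀ ((1 / 2 : ℝ) • (y + u n))) atTop
      (𝓝 (qhDist Ω x₀ y))) : Tendsto u atTop (𝓝 y) := by
  -- At radius zero every point equals `x₀`. Otherwise each subsequence has a further one converging
  -- to `y`.
  rcases (qhDist_nonneg Ω x₀ y).eq_or_lt with h0 | hpos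
  · have hz : ∀ z ∈ Ω, qhDist Ω x₀ z = 0 → z = x₀ := fun z hz hz0 => by
      have := hΩ.norm_sub_le_qhDist hx₀ hz
      rw [hz0, Real.exp_zero, sub_self, mul_zero] at this
      exact sub_eq_zero.1 (norm_le_zero_iff.1 this)
    have hun : ∀ n, u n = y := fun n => by
      rw [hz y hy h0.symm, hz _ (hu n) ((heq n).trans h0.symm)]
    rw [funext hun]; exact tendsto_const_nhds
  · refine tendsto_of_subseq_tendsto fun ns hns => ?_
    exact exists_subseq_tendsto_of_tendsto_qhDist_midpoint hLUR hrefl hΩ hx₀ hy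
      (fun n => hu (ns n)) hpos (fun n => heq (ns n)) (hlim.comp hns)

end LocallyUniformlyRotund

/-! ### Quasihyperbolic balls and their Minkowski functionals. -/

section Balls

variable {X : Type*} [NormedAddCommGroup X] [NormedSpace ℝ X] {Ω : Set X}

namespace IsProperConvexDomain

theorem bdryDist_le_mul_exp (hΩ : IsProperConvexDomain Ω) {x y : X} (hx : x ∈ Ω) (hy : y ∈ Ω) :
    bdryDist Ω x ≤ bdryDist Ω y * Real.exp (qhDist Ω x y) := by
  have h1 := hΩ.norm_sub_le_qhDist hy hx
  have h2 := bdryDist_le_add (Ω := Ω) x y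
  rw [hΩ.qhDist_comm hy hx] at h1
  linarith

theorem le_bdryDist_of_mem_qhClosedBall (hΩ : IsProperConvexDomain Ω) {x y : X} {r : ℝ}
    (hx : x ∈ Ω) (hy : y ∈ qhClosedBall Ω x r) : bdryDist Ω x * Real.exp (-r) ≤ bdryDist Ω y := by
  rw [Real.exp_neg, ← div_eq_mul_inv, div_le_iff₀ (Real.exp_pos _)]
  refine (hΩ.bdryDist_le_mul_exp hx hy.1).trans ?_
  have := (hΩ.bdryDist_pos hy.1).le
  gcongr; exact hy.2

theorem qhDist_self (hΩ : IsProperConvexDomain Ω) {x : X} (hx : x ∈ Ω) : qhDist Ω x x = 0 := by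
  refine le_antisymm ?_ (qhDist_nonneg _ _ _)
  simpa using hΩ.qhDist_le_div hx hx (hΩ.bdryDist_pos hx) le_rfl le_rfl

/-- Average two curves of the same duration `R` starting at the centre. -/
theorem convex_qhClosedBall (hΩ : IsProperConvexDomain Ω) {x : X} (hx : x ∈ Ω) (r : ℝ) :
    Convex ℝ (qhClosedBall Ω x r) := by
  intro y hy z hz a b ha hb hab
  refine ⟨hΩ.convex hy.1 hz.1 ha hb hab, le_of_forall_gt_imp_ge_of_dense fun R hR => ?_⟩
  obtain ⟨γ₁, h₁, h10, h11⟩ := hΩ.exists_isQHCurve_of_lt hx hy.1 (hy.2.trans_lt hR)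
  obtain ⟨γ₂, h₂, h20, h21⟩ := hΩ.exists_isQHCurve_of_lt hx hz.1 (hz.2.trans_lt hR)
  have hR0 : 0 ≤ R := ((qhDist_nonneg Ω x y).trans hy.2).trans hR.le
  have := (h₁.convex_comb hΩ h₂ ha hb hab).qhDist_le hΩ hR0
  rwa [h10, h20, h11, h21, ← add_smul, hab, one_smul] at this

theorem convex_qhBall (hΩ : IsProperConvexDomain Ω) {x : X} (hx : x ∈ Ω) (r : ℝ) :
    Convex ℝ (qhBall Ω x r) := by
  intro y hy z hz a b ha hb hab
  have := hΩ.convex_qhClosedBall hx (max (qhDist Ω x y) (qhDist Ω x z))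
    ⟨hy.1, le_max_left _ _⟩ ⟨hz.1, le_max_right _ _⟩ ha hb hab
  exact ⟨this.1, this.2.trans_lt (max_lt hy.2 hz.2)⟩

theorem isOpen_qhBall (hΩ : IsProperConvexDomain Ω) {x : X} (hx : x ∈ Ω) (r : ℝ) :
    IsOpen (qhBall Ω x r) := by
  rw [isOpen_iff_mem_nhds]
  intro y hy
  filter_upwards [hΩ.isOpen.mem_nhds hy.1,
    (hΩ.continuousAt_qhDist hx hy.1).eventually (gt_mem_nhds hy.2)] with z h1 h2
  exact ⟨h1, h2⟩

/-- On the ball `d` is bounded below by `d(x) e^{-r}`, so limits in `X` cannot leave `Ω`. -/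
theorem isClosed_qhClosedBall (hΩ : IsProperConvexDomain Ω) {x : X} (hx : x ∈ Ω) (r : ℝ) :
    IsClosed (qhClosedBall Ω x r) := by
  rw [← isSeqClosed_iff_isClosed]
  intro u y hu hy
  have hc : 0 < bdryDist Ω x * Real.exp (-r) := mul_pos (hΩ.bdryDist_pos hx) (Real.exp_pos _)
  have hyΩ : y ∈ Ω := ((hΩ.isClosed_setOf_le_bdryDist hc).mem_of_tendsto hy
    (Eventually.of_forall fun n => ⟨(hu n).1, hΩ.le_bdryDist_of_mem_qhClosedBall hx (hu n)⟩)).1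
  exact ⟨hyΩ, le_of_tendsto' ((hΩ.continuousAt_qhDist hx hyΩ).tendsto.comp hy) fun n => (hu n).2⟩

theorem qhClosedBall_subset_closedBall (hΩ : IsProperConvexDomain Ω) {x : X} (hx : x ∈ Ω) (r : ℝ) :
    qhClosedBall Ω x r ⊆ Metric.closedBall x (bdryDist Ω x * (Real.exp r - 1)) := by
  intro y hy
  rw [Metric.mem_closedBall, dist_eq_norm]
  refine (hΩ.norm_sub_le_qhDist hx hy.1).trans ?_
  have := (hΩ.bdryDist_pos hx).le
  gcongr; exact hy.2

theorem zero_mem (hΩ : IsProperConvexDomain Ω) (hsymm : ∀ x ∈ Ω, -x ∈ Ω) : (0 : X) ∈ Ω := by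
  obtain ⟨z, hz⟩ := hΩ.nonempty
  have := hΩ.convex hz (hsymm z hz) (a := 1 / 2) (b := 1 / 2) (by norm_num) (by norm_num)
    (by norm_num)
  rwa [smul_neg, add_neg_cancel] at this

theorem bdryDist_le_bdryDist_neg (hΩ : IsProperConvexDomain Ω) (hsymm : ∀ x ∈ Ω, -x ∈ Ω) {z : X}
    (hz : z ∈ Ω) : bdryDist Ω z ≤ bdryDist Ω (-z) := by
  refine hΩ.le_bdryDist_of_ball_subset fun w hw => ?_
  rw [← neg_neg w]
  refine hsymm _ (hΩ.ball_subset hz ?_)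
  rwa [Metric.mem_ball, ← dist_neg_neg, neg_neg]

theorem qhDist_zero_neg_le (hΩ : IsProperConvexDomain Ω) (hsymm : ∀ x ∈ Ω, -x ∈ Ω) {y : X}
    (hy : y ∈ Ω) : qhDist Ω 0 (-y) ≤ qhDist Ω 0 y := by
  refine le_of_forall_gt_imp_ge_of_dense fun R hR => ?_
  obtain ⟨γ, hγ, h0, h1⟩ := hΩ.exists_isQHCurve_of_lt (hΩ.zero_mem hsymm) hy hR
  have hneg : IsQHCurve Ω fun t => -γ t := by
    refine ⟨fun t => hsymm _ (hγ.mem t), fun s t => ?_⟩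
    rw [← neg_sub', norm_neg]
    have h2 := hΩ.bdryDist_le_bdryDist_neg hsymm (hγ.mem s)
    have h3 : 0 ≤ Real.exp |t - s| - 1 := sub_nonneg.2 (Real.one_le_exp (abs_nonneg _))
    exact (hγ.norm_sub_le s t).trans (by gcongr)
  have := hneg.qhDist_le hΩ ((qhDist_nonneg Ω 0 y).trans hR.le)
  rwa [h0, h1, neg_zero] at this

theorem neg_mem_qhClosedBall (hΩ : IsProperConvexDomain Ω) (hsymm : ∀ x ∈ Ω, -x ∈ Ω) {r : ℝ} :
    ∀ y ∈ qhClosedBall Ω 0 r, -y ∈ qhClosedBall Ω 0 r := fun y hy =>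
  ⟨hsymm y hy.1, (hΩ.qhDist_zero_neg_le hsymm hy.1).trans hy.2⟩

theorem neg_mem_qhBall (hΩ : IsProperConvexDomain Ω) (hsymm : ∀ x ∈ Ω, -x ∈ Ω) {r : ℝ} :
    ∀ y ∈ qhBall Ω 0 r, -y ∈ qhBall Ω 0 r := fun y hy =>
  ⟨hsymm y hy.1, (hΩ.qhDist_zero_neg_le hsymm hy.1).trans_lt hy.2⟩

end IsProperConvexDomain

theorem isEquivalentNorm_gauge {S : Set X} (hconv : Convex ℝ S) (hneg : ∀ x ∈ S, -x ∈ S)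
    (h0 : S ∈ 𝓝 0) {M : ℝ} (hM : 0 < M) (hSM : S ⊆ Metric.closedBall 0 M) :
    IsEquivalentNorm (gauge S) where
  add_le := gauge_add_le hconv (absorbent_nhds_zero h0)
  smul a x := by
    rcases le_total 0 a with ha | ha
    · rw [gauge_smul_of_nonneg ha, abs_of_nonneg ha, smul_eq_mul]
    · rw [← gauge_neg hneg, ← neg_smul, gauge_smul_of_nonneg (neg_nonneg.2 ha),
        abs_of_nonpos ha, smul_eq_mul]
  equivalent := by
    obtain ⟨ρ, hρ, hball⟩ := Metric.mem_nhds_iff.1 h0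
    refine ⟨1 / M, 1 / ρ, by positivity, by positivity, fun x => ⟨?_, ?_⟩⟩
    · have := le_gauge_of_subset_closedBall (absorbent_nhds_zero h0) hM.le hSM (x := x)
      rwa [one_div, inv_mul_eq_div]
    · have := mul_gauge_le_norm hball (x := x)
      rwa [one_div, inv_mul_eq_div, le_div_iff₀ hρ, mul_comm]

/-- Any symmetric convex `S` between the open and closed balls will do. When the gauges of midpoints
tend to `1`, radial rescaling onto the sphere moves them by `o(1)` in norm, hence in `k`, since `d ≥
c` on the ball; so (i) applies. -/
theorem isEquivalentNorm_and_isLUR_gauge (hLUR : IsLURSpace X) (hrefl : IsReflexiveSpace X)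
    (hΩ : IsProperConvexDomain Ω) (h0Ω : (0 : X) ∈ Ω) {r : ℝ} (hr : 0 < r) {S : Set X}
    (hconv : Convex ℝ S) (hneg : ∀ x ∈ S, -x ∈ S) (hle : qhBall Ω 0 r ⊆ S)
    (hge : S ⊆ qhClosedBall Ω 0 r) : IsEquivalentNorm (gauge S) ∧ IsLUR (gauge S) := by
  have h0 : S ∈ 𝓝 0 := mem_of_superset ((hΩ.isOpen_qhBall h0Ω r).mem_nhds
    ⟨h0Ω, by rwa [hΩ.qhDist_self h0Ω]⟩) hle
  have hd0 := hΩ.bdryDist_pos h0Ω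
  set M := bdryDist Ω (0 : X) * (Real.exp r - 1) with hM
  have hMpos : 0 < M := mul_pos hd0 (sub_pos.2 (Real.one_lt_exp_iff.2 hr))
  have hCM := hΩ.qhClosedBall_subset_closedBall h0Ω r
  have hnorm := isEquivalentNorm_gauge hconv hneg h0 hMpos (hge.trans hCM)
  refine ⟨hnorm, fun x u hx hu hlim => ?_⟩
  -- Gauge at most `1` means membership in the closure of `S`, within the closed ball; gauge below
  -- `1` means interior, which contains the open ball.
  have hone : ∀ y, gauge S y = 1 → y ∈ Ω ∧ qhDist Ω 0 y = r := by
    intro y hy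
    have h1 : y ∈ qhClosedBall Ω 0 r := closure_minimal hge (hΩ.isClosed_qhClosedBall h0Ω r)
      ((gauge_le_one_iff_mem_closure hconv h0).1 hy.le)
    refine ⟨h1.1, h1.2.eq_of_not_lt fun hlt => ?_⟩
    have h2 : y ∈ interior S :=
      interior_maximal hle (hΩ.isOpen_qhBall h0Ω r) ⟨h1.1, hlt⟩
    have := (gauge_lt_one_iff_mem_interior hconv h0).2 h2
    linarith
  have honeC : ∀ y, gauge S y = 1 → y ∈ qhClosedBall Ω 0 r := fun y hy =>
    ⟨(hone y hy).1, (hone y hy).2.le⟩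
  set m : ℕ → X := fun n => (1 / 2 : ℝ) • (x + u n) with hm
  have hmC : ∀ n, m n ∈ qhClosedBall Ω 0 r := fun n => by
    have := hΩ.convex_qhClosedBall h0Ω r (honeC x hx) (honeC _ (hu n)) (a := 1 / 2) (b := 1 / 2)
      (by norm_num) (by norm_num) (by norm_num)
    rwa [← smul_add] at this
  set c := bdryDist Ω (0 : X) * Real.exp (-r) with hc
  have hcpos : 0 < c := mul_pos hd0 (Real.exp_pos _)
  have hk : Tendsto (fun n => qhDist Ω 0 (m n)) atTop (𝓝 r) := by
    have hlow : Tendsto (fun n => r - |1 - (gauge S (m n))⁻¹| * M / c) atTop (𝓝 r) := by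
      have h1 : Tendsto (fun n => |1 - (gauge S (m n))⁻¹|) atTop (𝓝 |1 - (1 : ℝ)⁻¹|) :=
        ((hlim.inv₀ one_ne_zero).const_sub 1).abs
      have h2 := ((h1.mul_const M).div_const c).const_sub r
      simpa using h2
    refine tendsto_of_tendsto_of_tendsto_of_le_of_le' hlow tendsto_const_nhds ?_
      (Eventually.of_forall fun n => (hmC n).2)
    filter_upwards [hlim.eventually (lt_mem_nhds one_pos)] with n hn
    have h1 : gauge S ((gauge S (m n))⁻¹ • m n) = 1 := by
      rw [gauge_smul_of_nonneg (inv_nonneg.2 hn.le), smul_eq_mul, inv_mul_cancel₀ hn.ne']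
    have h2 := hΩ.qhDist_triangle h0Ω (hmC n).1 (hone _ h1).1
    have h3 := hΩ.qhDist_le_div (hmC n).1 (hone _ h1).1 hcpos
      (hΩ.le_bdryDist_of_mem_qhClosedBall h0Ω (hmC n))
      (hΩ.le_bdryDist_of_mem_qhClosedBall h0Ω (honeC _ h1))
    have h4 : ‖m n - (gauge S (m n))⁻¹ • m n‖ ≤ |1 - (gauge S (m n))⁻¹| * M := by
      have e1 : m n - (gauge S (m n))⁻¹ • m n = (1 - (gauge S (m n))⁻¹) • m n := by module
      rw [e1, norm_smul, Real.norm_eq_abs]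
      gcongr
      exact mem_closedBall_zero_iff.1 (hCM (hmC n))
    have h5 : ‖m n - (gauge S (m n))⁻¹ • m n‖ / c ≤ |1 - (gauge S (m n))⁻¹| * M / c := by
      gcongr
    rw [(hone _ h1).2] at h2
    linarith
  have hxr := (hone x hx).2
  have hux : Tendsto u atTop (𝓝 x) :=
    tendsto_of_tendsto_qhDist_midpoint hLUR hrefl hΩ h0Ω (hone x hx).1 (fun n => (hone _ (hu n)).1)
      (fun n => by rw [(hone _ (hu n)).2, hxr]) (by rw [hxr]; exact hk)
  obtain ⟨_, C, -, -, hC⟩ := hnorm.equivalent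
  refine squeeze_zero (fun _ => gauge_nonneg _) (fun n => (hC (u n - x)).2) ?_
  simpa using (tendsto_iff_norm_sub_tendsto_zero.1 hux).const_mul C

end Balls

end

theorem theorem3p2 {X : Type*} [NormedAddCommGroup X] [NormedSpace ℝ X] [CompleteSpace X]
    (hLUR : IsLURSpace X) (hrefl : IsReflexiveSpace X)
    (Ω : Set X) (hopen : IsOpen Ω) (hne : Ω.Nonempty) (hproper : Ω ≠ Set.univ)
    (hconv : Convex ℝ Ω) :
    (∀ (x₀ y : X) (u : ℕ → X), x₀ ∈ Ω → y ∈ Ω → (∀ n, u n ∈ Ω) →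
      (∀ n, qhDist Ω x₀ (u n) = qhDist Ω x₀ y) →
      Tendsto (fun n => qhDist Ω x₀ ((1 / 2 : ℝ) • (y + u n))) atTop (𝓝 (qhDist Ω x₀ y)) →
      Tendsto u atTop (𝓝 y)) ∧
    ((∀ x ∈ Ω, -x ∈ Ω) → ∀ r : ℝ, 0 < r →
      (IsEquivalentNorm (gauge (qhBall Ω 0 r)) ∧ IsLUR (gauge (qhBall Ω 0 r))) ∧
      (IsEquivalentNorm (gauge (qhClosedBall Ω 0 r)) ∧ IsLUR (gauge (qhClosedBall Ω 0 r)))) := by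
  have hΩ : IsProperConvexDomain Ω := ⟨hopen, hne, hproper, hconv⟩
  refine ⟨fun x₀ y u hx₀ hy hu heq hlim =>
    tendsto_of_tendsto_qhDist_midpoint hLUR hrefl hΩ hx₀ hy hu heq hlim,
    fun hsymm r hr => ?_⟩
  have h0 := hΩ.zero_mem hsymm
  have hsub : qhBall Ω 0 r ⊆ qhClosedBall Ω 0 r := fun y hy => ⟨hy.1, hy.2.le⟩
  exact ⟨isEquivalentNorm_and_isLUR_gauge hLUR hrefl hΩ h0 hr (hΩ.convex_qhBall h0 r)
      (hΩ.neg_mem_qhBall hsymm) Subset.rfl hsub,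
    isEquivalentNorm_and_isLUR_gauge hLUR hrefl hΩ h0 hr (hΩ.convex_qhClosedBall h0 r)
      (hΩ.neg_mem_qhClosedBall hsymm) hsub Subset.rfl⟩
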